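/- Let $\mathbb N=\{1,2,3,\dots\}$, and let $\log^{(i)}$ denote the $i$-fold iterate of the natural logarithm. For $d\in\mathbb N$ and $\psi:\mathbb N\to\mathbb R$ (a function defined for all sufficiently large integers suffices), let $\mathcal W_d(\psi)$ be the set of $\boldsymbol x\in\mathbb R^d$ such that $\|q\boldsymbol x-\boldsymbol p\|_\infty<\psi(q)$ holds for infinitely many $(\boldsymbol p,q)\in\mathbb Z^d\times\mathbb N$. The Diophantine type of $x\in\mathbb R$ is the supremum in $[0,\infty]$ of all real $\tau>0$ such that $x\in\mathcal W_1(q\mapsto q^{-\tau})$ (so rational numbers have Diophantine type $\infty$). The regular Diophantine type of an irrational number $x$, with continued fraction denominators (continuants) $q_0=1,q_1,q_2,\dots$, is the supremum in $[1,\infty]$ of all real $\sigma\ge 1$ for which there is a set $A\subseteq\mathbb N$ with $\liminf_{N\to\infty}|A\cap[1,N]|/N>0$ such that $q_n^{\sigma}<q_{n+1}$ for all $n\in A$. **Theorem.** Let $d\ge 3$ and $s\ge 0$ be integers, and let $$\psi_{s,d}(q)=\bigl(q\cdot\log q\cdot\log\log q\cdots\log^{(s)}q\bigr)^{-1/d}$$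 for all sufficiently large $q$. Let $x\in\mathbb R$ be a number whose Diophantine type is greater than $d$, or an irrational number whose regular Diophantine type is greater than $1$. Then $\{x\}\times\mathbb R^{d-1}$ is full in $\mathcal W_d(\psi_{s,d})$, that is, for Lebesgue-almost every $\boldsymbol y\in\mathbb R^{d-1}$ the point $(x,\boldsymbol y)$ belongs to $\mathcal W_d(\psi_{s,d})$. -/

import Mathlib

open scoped ENNReal

noncomputable section

/-- `𝒲_d(ψ)`: the vectors `x ∈ ℝ^d` for which `‖q x - p‖_∞ < ψ(q)` holds for infinitely many
`(p, q) ∈ ℤ^d × ℕ`, `q ≥ 1`. (The norm of `Fin d → ℝ` is the sup norm.) -/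
def approximableSet (d : ℕ) (ψ : ℕ → ℝ) : Set (Fin d → ℝ) :=
  {x | {pq : (Fin d → ℤ) × ℕ |
    0 < pq.2 ∧ ‖(pq.2 : ℝ) • x - (fun i => (pq.1 i : ℝ))‖ < ψ pq.2}.Infinite}

/-- The Diophantine type of `x ∈ ℝ^d`: the supremum, in `[0, ∞]`, of the `τ > 0` such that
`x` is approximable at the rate `q ↦ q ^ (-τ)`. -/
def diophantineType {d : ℕ} (x : Fin d → ℝ) : ℝ≥0∞ :=
  ⨆ (τ : ℝ) (_ : 0 < τ) (_ : x ∈ approximableSet d (fun q => (q : ℝ) ^ (-τ))), ENNReal.ofReal τ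

/-- The lower asymptotic density `liminf_{N → ∞} |A ∩ [1, N]| / N` of `A ⊆ ℕ`. -/
def lowerAsymptoticDensity (A : Set ℕ) : ℝ :=
  Filter.liminf (fun N : ℕ => ((A ∩ Set.Icc 1 N).ncard : ℝ) / (N : ℝ)) Filter.atTop

/-- The continuants `q_0 = 1, q_1 = a_1, q_{n+2} = a_{n+2} q_{n+1} + q_n` of the simple continued
fraction expansion `[a_0; a_1, a_2, …]` of `x`. -/
def continuantDen (x : ℝ) (n : ℕ) : ℝ :=
  (GenContFract.of x).dens n

/-- The regularly `σ`-approximable numbers: `q_n ^ σ < q_{n+1}` along a sequence of indices `n`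
of positive lower asymptotic density. -/
def regularlyApproximable (σ : ℝ) : Set ℝ :=
  {x | ∃ A : Set ℕ, 0 < lowerAsymptoticDensity A ∧
    ∀ n ∈ A, continuantDen x n ^ σ < continuantDen x (n + 1)}

/-- The regular Diophantine type of `x`: the supremum, in `[0, ∞]`, of the `σ ∈ [1, ∞)` such that
`x` is regularly `σ`-approximable. -/
def regularDiophantineType (x : ℝ) : ℝ≥0∞ :=
  ⨆ (σ : ℝ) (_ : 1 ≤ σ) (_ : x ∈ regularlyApproximable σ), ENNReal.ofReal σ

/-- `ψ_{s,d}(q) = (q · log q · log log q ⋯ log^{(s)} q) ^ (-1/d)`, where `log^{(s)}` is the `s`-th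
iterate of the natural logarithm. The values at the finitely many `q` at which some iterated
logarithm is undefined or not positive have no influence on `approximableSet d (psi s d)`. -/
def psi (s d : ℕ) (q : ℕ) : ℝ :=
  (∏ i ∈ Finset.range (s + 1), Real.log^[i] (q : ℝ)) ^ (-(1 / (d : ℝ)))

/-- The point `(x, y) ∈ {x} × ℝ^{d-1} ⊆ ℝ^d`. -/
def fiberPoint {d : ℕ} (x : ℝ) (y : Fin (d - 1) → ℝ) : Fin d → ℝ :=
  fun i => if h : i.val = 0 then x else y ⟨i.val - 1, by omega⟩

/-- The set `S ⊆ ℝ^d` is full on the fiber `{x} × ℝ^{d-1}`: the complement of `S` in the fiber is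
null for the Lebesgue measure `m_{d-1}` of the fiber. -/
def FullOnFiber {d : ℕ} (S : Set (Fin d → ℝ)) (x : ℝ) : Prop :=
  MeasureTheory.volume {y : Fin (d - 1) → ℝ | fiberPoint x y ∉ S} = 0

end

/-! Put `m = d - 1`, let `f` be `psi (s + 1) d` flattened on an initial segment (`truncatedPsi`),
and let `B` be the set of `q` with `‖q x‖ < f q` (`nearIntegerDens x f`). For `q ∈ B` the first
coordinate is already well approximated, so it remains to show that almost every `y` has `q y`
within `c * f q` of an integer vector for infinitely many `q ∈ B`, with `c` depending on `y`. Any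
such `c` is harmless: `f` is smaller than `psi s d` by the factor `log^{(s+1)}(q) ^ (-1/d)`, which
tends to `0`. The argument runs for arbitrary `x`.

Divergence: by Dirichlet's pigeonhole argument `B` has at least about `2^j * f (2^j)` elements up to
`2^j`. Hence `∑ f q ^ m` over `B` diverges, because `∑ 2^j * f (2^j) ^ d` does
(`not_summable_indicator_nearIntegerDens`).

Quasi-independence: the sets `torusNear m q (f q)`, `q ∈ B`, overlap too much only for pairs `l < k`
with `gcd(k, l) > 2 * f l * k`. Then `k / gcd(k, l)` divides both `k` and the integer nearest to `k
x` (`div_gcd_dvd_roundGcd`). Divisibility by `j` of both numbers concerns at most a proportion `1 /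
j` of the weight (`sum_dvd_roundGcd_le`), and for `m ≥ 2` this makes the excess summable against `1
/ j^2`. The Chung-Erdős inequality then gives a limsup set of positive measure.

Zero-one law: the union over `c` of the limsup sets with radii `c * f q` is carried into itself by
`y ↦ 2 y`, which is ergodic on the torus, so it has full measure (`ae_frequently_torusNear`). -/

open MeasureTheory

/-! ### Overlap estimates on the circle and the torus -/

/-- The integers `l i - k * round (z + l i / k)` lie in a window of length `2 b k`, and they are
distinct modulo `k` because `l` is invertible there. -/
lemma card_round_lt_le {k l : ℕ} (hk : 0 < k) (hkl : k.Coprime l) {b : ℝ} (hb : 0 < b) (z : ℝ) :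
    (((Finset.range k).filter
      (fun i : ℕ => |(z + l * i / k) - round (z + l * i / k)| < b)).card : ℝ) ≤ 2 * b * k + 1 := by
  have hk' : (0 : ℝ) < k := by exact_mod_cast hk
  set u : ℝ := -(k * z) - k * b
  set v : ℝ := -(k * z) + k * b
  have huv : u < v := by
    have : 0 < (k : ℝ) * b := by positivity
    simp only [u, v]; linarith
  have hcard : ((Finset.range k).filter
      (fun i : ℕ => |(z + l * i / k) - round (z + l * i / k)| < b)).card
      ≤ (Finset.Ioo ⌊u⌋ ⌈v⌉).card := by
    apply Finset.card_le_card_of_injOn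
      (fun i : ℕ => (l * i : ℤ) - k * round (z + l * i / k : ℝ))
    · intro i hi
      have h := abs_lt.1 (Finset.mem_filter.1 hi).2
      have e : (k : ℝ) * ((z + l * i / k) - round (z + l * i / k : ℝ))
          = k * z + (((l * i : ℤ) - k * round (z + l * i / k : ℝ) : ℤ) : ℝ) := by
        push_cast; field_simp; ring
      have h1 := mul_lt_mul_of_pos_left h.1 hk'
      have h2 := mul_lt_mul_of_pos_left h.2 hk'
      rw [e] at h1 h2
      simp only [Finset.coe_Ioo, Set.mem_Ioo]
      constructor
      · rw [Int.floor_lt]; simp only [u]; linarith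
      · rw [Int.lt_ceil]; simp only [v]; linarith
    · intro i hi j hj hij
      have hi' := Finset.mem_range.1 (Finset.mem_filter.1 hi).1
      have hj' := Finset.mem_range.1 (Finset.mem_filter.1 hj).1
      simp only at hij
      have hd : (k : ℤ) ∣ l * ((i : ℤ) - j) :=
        ⟨round (z + l * i / k : ℝ) - round (z + l * j / k : ℝ), by linarith⟩
      have hd' : (k : ℤ) ∣ (i : ℤ) - j :=
        (Int.isCoprime_iff_gcd_eq_one.2 (by simpa using hkl)).dvd_of_dvd_mul_left hd
      have : (i : ℤ) - j = 0 := by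
        apply Int.eq_zero_of_abs_lt_dvd hd'
        rw [abs_lt]; constructor <;> omega
      omega
  have hfc : (⌊u⌋ : ℝ) < ⌈v⌉ := lt_of_le_of_lt (Int.floor_le u) (huv.trans_le (Int.le_ceil v))
  have hc2 : ((Finset.Ioo ⌊u⌋ ⌈v⌉).card : ℤ) = ⌈v⌉ - ⌊u⌋ - 1 := by
    rw [Int.card_Ioo, Int.toNat_of_nonneg]
    have : ⌊u⌋ < ⌈v⌉ := by exact_mod_cast hfc
    omega
  have hc3 : ((Finset.Ioo ⌊u⌋ ⌈v⌉).card : ℝ) = ⌈v⌉ - ⌊u⌋ - 1 := by exact_mod_cast hc2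
  have h1 := Int.ceil_lt_add_one v
  have h2 := Int.sub_one_lt_floor u
  calc _ ≤ ((Finset.Ioo ⌊u⌋ ⌈v⌉).card : ℝ) := by exact_mod_cast hcard
    _ ≤ v - u + 1 := by rw [hc3]; linarith
    _ = 2 * b * k + 1 := by simp only [u, v]; ring

lemma UnitAddCircle.measurePreserving_nsmul {k : ℕ} (hk : 0 < k) :
    MeasurePreserving (fun y : UnitAddCircle => k • y) volume volume := by
  have := Measure.measurePreserving_zsmul (volume : Measure UnitAddCircle) (n := (k : ℤ)) (by omega)
  simpa using this

lemma UnitAddCircle.measurableSet_norm_nsmul_lt (k : ℕ) (a : ℝ) :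
    MeasurableSet {y : UnitAddCircle | ‖k • y‖ < a} := by
  apply IsOpen.measurableSet
  exact isOpen_lt (by fun_prop) continuous_const

lemma UnitAddCircle.volume_norm_nsmul_lt {k : ℕ} (hk : 0 < k) {a : ℝ} (ha : a ≤ 1 / 2) :
    volume {y : UnitAddCircle | ‖k • y‖ < a} = ENNReal.ofReal (2 * a) := by
  have h := (UnitAddCircle.measurePreserving_nsmul hk).measure_preimage
    (s := Metric.ball 0 a) Metric.isOpen_ball.measurableSet.nullMeasurableSet
  have e : (fun y : UnitAddCircle => k • y) ⁻¹' Metric.ball 0 a = {y | ‖k • y‖ < a} := by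
    ext y; simp
  rw [← e, h, ← measure_congr AddCircle.closedBall_ae_eq_ball, AddCircle.volume_closedBall,
    min_eq_right (by linarith)]

/-- The first set is invariant under translation by `1 / k`. Averaging over these `k` translations
replaces the indicator of the second set by the proportion of `i < k` counted in `card_round_lt_le`,
at most `2 b + 1 / k`. -/
lemma UnitAddCircle.volume_inter_le_of_coprime {k l : ℕ} (hk : 0 < k) (hkl : k.Coprime l)
    {a b : ℝ} (ha0 : 0 < a) (ha : a ≤ 1 / 2) (hb : 0 < b) :
    volume ({y : UnitAddCircle | ‖k • y‖ < a} ∩ {y | ‖l • y‖ < b})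
      ≤ ENNReal.ofReal (4 * a * b + 2 * a / k) := by
  set A := {y : UnitAddCircle | ‖k • y‖ < a} with hA
  set B := {y : UnitAddCircle | ‖l • y‖ < b} with hB
  have hAm : MeasurableSet A := UnitAddCircle.measurableSet_norm_nsmul_lt k a
  have hBm : MeasurableSet B := UnitAddCircle.measurableSet_norm_nsmul_lt l b
  have hk' : (0 : ℝ) < k := by exact_mod_cast hk
  let t : UnitAddCircle := ((1 / k : ℝ) : UnitAddCircle)
  have hkt : k • t = 0 := by
    simp only [t]
    rw [← AddCircle.coe_nsmul, nsmul_eq_mul, mul_one_div_cancel hk'.ne']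
    exact AddCircle.coe_period 1
  have hAt (i : ℕ) (y : UnitAddCircle) : y + i • t ∈ A ↔ y ∈ A := by
    simp only [hA, Set.mem_ofPred_eq]
    rw [smul_add, smul_comm k i t, hkt, smul_zero, add_zero]
  have htrans (i : ℕ) : volume (A ∩ B)
      = ∫⁻ y, (A.indicator (fun y => B.indicator (fun _ => (1 : ℝ≥0∞)) (y + i • t))) y := by
    rw [← measure_preimage_add_right volume (i • t) (A ∩ B),
      ← lintegral_indicator_one (measurable_add_const _ (hAm.inter hBm))]
    congr 1
    ext y
    by_cases h1 : y ∈ A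
    · by_cases h2 : y + i • t ∈ B <;> simp [Set.indicator, h1, h2, hAt]
    · simp [Set.indicator, h1, hAt]
  have hpt (y : UnitAddCircle) :
      ∑ i ∈ Finset.range k, (A.indicator (fun y => B.indicator (fun _ => (1 : ℝ≥0∞))
        (y + i • t))) y ≤ A.indicator (fun _ => ENNReal.ofReal (2 * b * k + 1)) y := by
    by_cases h1 : y ∈ A
    · simp only [Set.indicator_of_mem h1]
      simp only [Set.indicator, Finset.sum_ite, Finset.sum_const_zero, add_zero, Finset.sum_const,
        nsmul_eq_mul, mul_one]
      induction y using QuotientAddGroup.induction_on with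
      | H z =>
      have hmem (i : ℕ) : (((z : ℝ) : UnitAddCircle) + i • t ∈ B) ↔
          |(l * z + l * i / k) - round (l * z + l * i / k)| < b := by
        rw [hB, Set.mem_ofPred_eq, ← UnitAddCircle.norm_eq]
        have : l • (((z : ℝ) : UnitAddCircle) + i • t)
            = ((l * z + l * i / k : ℝ) : UnitAddCircle) := by
          simp only [t]
          rw [← AddCircle.coe_nsmul, ← AddCircle.coe_add, ← AddCircle.coe_nsmul]
          congr 1
          simp only [nsmul_eq_mul]
          ring
        rw [this]
      have := card_round_lt_le hk hkl hb (l * z)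
      rw [← ENNReal.ofReal_natCast]
      apply ENNReal.ofReal_le_ofReal
      refine le_trans (le_of_eq ?_) this
      congr 2
      ext i
      simp only [Finset.mem_filter]
      exact and_congr_right fun _ => hmem i
    · simp [Set.indicator_of_notMem h1]
  have hmeas (i : ℕ) : Measurable (A.indicator (fun y => B.indicator (fun _ => (1 : ℝ≥0∞))
      (y + i • t))) :=
    ((measurable_const.indicator hBm).comp (measurable_add_const _)).indicator hAm
  have hsum : (k : ℝ≥0∞) * volume (A ∩ B) ≤ ENNReal.ofReal (2 * b * k + 1) * volume A := by
    calc (k : ℝ≥0∞) * volume (A ∩ B)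
        = ∑ i ∈ Finset.range k, volume (A ∩ B) := by simp
      _ = ∑ i ∈ Finset.range k, ∫⁻ y, (A.indicator (fun y => B.indicator
            (fun _ => (1 : ℝ≥0∞)) (y + i • t))) y := Finset.sum_congr rfl fun i _ => htrans i
      _ = ∫⁻ y, ∑ i ∈ Finset.range k, (A.indicator (fun y => B.indicator
            (fun _ => (1 : ℝ≥0∞)) (y + i • t))) y :=
          (lintegral_finsetSum _ fun i _ => hmeas i).symm
      _ ≤ ∫⁻ y, A.indicator (fun _ => ENNReal.ofReal (2 * b * k + 1)) y := lintegral_mono hpt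
      _ = _ := lintegral_indicator_const hAm _
  rw [UnitAddCircle.volume_norm_nsmul_lt hk ha, ← ENNReal.ofReal_mul (by positivity)] at hsum
  have hk0 : (k : ℝ≥0∞) ≠ 0 := by exact_mod_cast hk.ne'
  rw [mul_comm, ← ENNReal.le_div_iff_mul_le (Or.inl hk0) (Or.inl (ENNReal.natCast_ne_top k)),
    ← ENNReal.ofReal_natCast, ← ENNReal.ofReal_div_of_pos hk'] at hsum
  refine hsum.trans (ENNReal.ofReal_le_ofReal (le_of_eq ?_))
  field_simp
  ring

/-- Multiplication by the gcd preserves measure, which reduces to the coprime case. -/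
lemma UnitAddCircle.volume_inter_le {k l : ℕ} (hk : 0 < k)
    {a b : ℝ} (ha0 : 0 < a) (ha : a ≤ 1 / 2) (hb : 0 < b) :
    volume ({y : UnitAddCircle | ‖k • y‖ < a} ∩ {y | ‖l • y‖ < b})
      ≤ ENNReal.ofReal (4 * a * b + 2 * a * k.gcd l / k) := by
  have hg : 0 < k.gcd l := Nat.gcd_pos_of_pos_left l hk
  obtain ⟨k', l', hcop, hk', hl'⟩ := Nat.exists_coprime k l
  set g := k.gcd l
  have hk'0 : 0 < k' := Nat.pos_of_ne_zero (by rintro rfl; omega)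
  have hgR : (0 : ℝ) < g := by exact_mod_cast hg
  have hkR : (0 : ℝ) < k' := by exact_mod_cast hk'0
  have h := UnitAddCircle.volume_inter_le_of_coprime hk'0 hcop ha0 ha hb
  rw [← (UnitAddCircle.measurePreserving_nsmul hg).measure_preimage
    ((UnitAddCircle.measurableSet_norm_nsmul_lt k' a).inter
      (UnitAddCircle.measurableSet_norm_nsmul_lt l' b)).nullMeasurableSet] at h
  have e1 : (k : ℝ) = k' * g := by exact_mod_cast hk'
  have e2 : 4 * a * b + 2 * a * g / k = 4 * a * b + 2 * a / k' := by
    rw [e1]; field_simp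
  rw [e2]
  refine le_trans (measure_mono ?_) h
  intro y hy
  simp only [Set.mem_inter_iff, Set.mem_ofPred_eq, Set.mem_preimage, smul_smul] at hy ⊢
  rwa [← hk', ← hl']

/-- The points `y` of the `m`-dimensional torus with `‖q y‖ < a` in the sup norm. -/
def torusNear (m q : ℕ) (a : ℝ) : Set (Fin m → UnitAddCircle) :=
  {y | ∀ i, ‖q • y i‖ < a}

lemma torusNear_eq_pi (m q : ℕ) (a : ℝ) :
    torusNear m q a = Set.univ.pi fun _ => {y : UnitAddCircle | ‖q • y‖ < a} := by
  ext y; simp [torusNear]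

lemma measurableSet_torusNear (m q : ℕ) (a : ℝ) : MeasurableSet (torusNear m q a) := by
  rw [torusNear_eq_pi]
  exact MeasurableSet.univ_pi fun _ => UnitAddCircle.measurableSet_norm_nsmul_lt q a

lemma volume_real_torusNear (m : ℕ) {q : ℕ} (hq : 0 < q) {a : ℝ} (ha0 : 0 < a) (ha : a ≤ 1 / 2) :
    volume.real (torusNear m q a) = (2 * a) ^ m := by
  rw [torusNear_eq_pi, measureReal_def, volume_pi_pi]
  simp [UnitAddCircle.volume_norm_nsmul_lt hq ha, ha0.le]

lemma volume_real_torusNear_inter_le (m : ℕ) {k l : ℕ} (hk : 0 < k)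
    {a b : ℝ} (ha0 : 0 < a) (ha : a ≤ 1 / 2) (hb : 0 < b) :
    volume.real (torusNear m k a ∩ torusNear m l b)
      ≤ (4 * a * b + 2 * a * k.gcd l / k) ^ m := by
  rw [torusNear_eq_pi, torusNear_eq_pi, ← Set.pi_inter_distrib, measureReal_def, volume_pi_pi]
  simp only [Finset.prod_const, Finset.card_univ, Fintype.card_fin, ENNReal.toReal_pow]
  gcongr
  exact ENNReal.toReal_le_of_le_ofReal (by positivity) (UnitAddCircle.volume_inter_le hk ha0 ha hb)

/-! ### Limsup sets of positive measure -/

/-- The Chung-Erdős lower bound for the measure of a finite union. -/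
lemma measureReal_biUnion_ge {Ω ι : Type*} [MeasurableSpace Ω] {μ : Measure Ω} [IsFiniteMeasure μ]
    (F : Finset ι) {E : ι → Set Ω} (hE : ∀ i, MeasurableSet (E i)) {K : ℝ} (hK : 0 < K)
    (hS : 0 < ∑ i ∈ F, μ.real (E i))
    (hQ : ∑ i ∈ F, ∑ j ∈ F, μ.real (E i ∩ E j) ≤ K * (∑ i ∈ F, μ.real (E i)) ^ 2) :
    1 / K ≤ μ.real (⋃ i ∈ F, E i) := by
  classical
  set S := ∑ i ∈ F, μ.real (E i)
  -- If `X` counts the sets containing a point, then `2 t X - t² X²` is at most the indicator of the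
  -- union. This `t` maximizes the integrated bound `2 t S - t² K S²`, with value `1 / K`.
  set t := 1 / (K * S)
  have ht : 0 < t := by positivity
  let e : ι → Ω → ℝ := fun i => (E i).indicator 1
  have hint (s : Set Ω) (hs : MeasurableSet s) : Integrable (s.indicator (1 : Ω → ℝ)) μ :=
    (integrable_const (1 : ℝ)).indicator hs
  have hUm : MeasurableSet (⋃ i ∈ F, E i) := F.measurableSet_biUnion fun i _ => hE i
  have hpt : ∀ ω, 2 * t * (∑ i ∈ F, e i ω)
      - t ^ 2 * (∑ i ∈ F, ∑ j ∈ F, (E i ∩ E j).indicator (1 : Ω → ℝ) ω)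
      ≤ (⋃ i ∈ F, E i).indicator (1 : Ω → ℝ) ω := by
    intro ω
    have hsq : ∑ i ∈ F, ∑ j ∈ F, (E i ∩ E j).indicator (1 : Ω → ℝ) ω = (∑ i ∈ F, e i ω) ^ 2 := by
      rw [sq, Finset.sum_mul_sum]
      refine Finset.sum_congr rfl fun i _ => Finset.sum_congr rfl fun j _ => ?_
      simp only [e, Set.inter_indicator_one, Pi.mul_apply]
    rw [hsq]
    by_cases hω : ω ∈ ⋃ i ∈ F, E i
    · rw [Set.indicator_of_mem hω, Pi.one_apply]
      nlinarith [sq_nonneg (t * (∑ i ∈ F, e i ω) - 1)]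
    · have : ∑ i ∈ F, e i ω = 0 := by
        refine Finset.sum_eq_zero fun i hi => Set.indicator_of_notMem (fun h => hω ?_) _
        exact Set.mem_biUnion hi h
      rw [this, Set.indicator_of_notMem hω]
      simp
  have hI1 : Integrable (fun ω => ∑ i ∈ F, e i ω) μ :=
    integrable_finsetSum _ fun i _ => hint _ (hE i)
  have hI2 : Integrable
      (fun ω => ∑ i ∈ F, ∑ j ∈ F, (E i ∩ E j).indicator (1 : Ω → ℝ) ω) μ :=
    integrable_finsetSum _ fun i _ => integrable_finsetSum _ fun j _ => hint _ ((hE i).inter (hE j))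
  have hmono := integral_mono ((hI1.const_mul (2 * t)).sub (hI2.const_mul (t ^ 2)))
    (hint _ hUm) hpt
  simp only [Pi.sub_apply] at hmono
  rw [integral_sub (hI1.const_mul _) (hI2.const_mul _), integral_const_mul, integral_const_mul,
    integral_finsetSum _ fun i _ => hint _ (hE i),
    integral_finsetSum _ fun i _ => integrable_finsetSum _ fun j _ =>
      hint _ ((hE i).inter (hE j)), integral_indicator_one hUm] at hmono
  simp only [integral_indicator_one (hE _)] at hmono
  have h2 : ∑ i ∈ F, ∫ ω, ∑ j ∈ F, (E i ∩ E j).indicator (1 : Ω → ℝ) ω ∂μ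
      = ∑ i ∈ F, ∑ j ∈ F, μ.real (E i ∩ E j) := by
    refine Finset.sum_congr rfl fun i _ => ?_
    rw [integral_finsetSum _ fun j _ => hint _ ((hE i).inter (hE j))]
    exact Finset.sum_congr rfl fun j _ => integral_indicator_one ((hE i).inter (hE j))
  rw [h2] at hmono
  have h3 : t ^ 2 * ∑ i ∈ F, ∑ j ∈ F, μ.real (E i ∩ E j) ≤ t ^ 2 * (K * S ^ 2) := by gcongr
  have h4 : 2 * t * S - t ^ 2 * (K * S ^ 2) = 1 / K := by
    simp only [t]; field_simp; ring
  change 2 * t * S - _ ≤ _ at hmono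
  linarith

lemma measure_frequently_pos {Ω : Type*} [MeasurableSpace Ω] {μ : Measure Ω} [IsFiniteMeasure μ]
    {E : ℕ → Set Ω} (hE : ∀ i, MeasurableSet (E i)) {c : ℝ} (hc : 0 < c)
    (h : ∀ M : ℕ, ∃ F : Finset ℕ, (∀ q ∈ F, M ≤ q) ∧ c ≤ μ.real (⋃ i ∈ F, E i)) :
    0 < μ {ω | ∃ᶠ q in Filter.atTop, ω ∈ E q} := by
  let G : ℕ → Set Ω := fun M => ⋃ q ≥ M, E q
  have hG : {ω | ∃ᶠ q in Filter.atTop, ω ∈ E q} = ⋂ M, G M := by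
    ext ω
    simp [G, Filter.frequently_atTop]
  have hGm (M : ℕ) : MeasurableSet (G M) := .iUnion fun q => .iUnion fun _ => hE q
  have hanti : Antitone G := fun M N hMN ω hω => by
    simp only [G, Set.mem_iUnion, exists_prop] at hω ⊢
    obtain ⟨q, hq, h⟩ := hω
    exact ⟨q, hMN.trans hq, h⟩
  have htend := tendsto_measure_iInter_atTop (μ := μ) (fun M => (hGm M).nullMeasurableSet) hanti
    ⟨0, measure_ne_top _ _⟩
  rw [hG]
  refine lt_of_lt_of_le (ENNReal.ofReal_pos.2 hc) (ge_of_tendsto' htend fun M => ?_)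
  obtain ⟨F, hF, hcF⟩ := h M
  refine le_trans ?_ (measure_mono (?_ : (⋃ i ∈ F, E i) ⊆ G M))
  · rw [← ofReal_measureReal (measure_ne_top _ _)]
    exact ENNReal.ofReal_le_ofReal hcF
  · intro ω hω
    simp only [G, Set.mem_iUnion, exists_prop] at hω ⊢
    obtain ⟨q, hq, h⟩ := hω
    exact ⟨q, hF q hq, h⟩

/-! ### Common divisors of a denominator and its nearest integer -/

/-- The positive integers `q` for which `q x` has distance less than `f q` to the nearest
integer. -/
def nearIntegerDens (x : ℝ) (f : ℕ → ℝ) : Set ℕ :=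
  {q | 0 < q ∧ |q * x - round (q * x)| < f q}

/-- The greatest common divisor of `q` and the integer nearest to `q x`. -/
noncomputable def roundGcd (x : ℝ) (q : ℕ) : ℕ := q.gcd (round (q * x)).natAbs

lemma round_eq_of_abs_sub_lt {y : ℝ} {n : ℤ} (h : |y - n| < 1 / 2) : round y = n := by
  rw [round_eq, Int.floor_eq_iff]
  have := abs_lt.1 h
  constructor <;> linarith

/-- Write `k = D h` and `round (k x) = D n` with `h`, `n` coprime. The smaller multiple `(D - i) h`
has error `(D - i) |h x - n|`, no larger than that of `k`, while its threshold is no smaller. Its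
nearest integer is `(D - i) n`, so coprimality gives the gcd `D - i`. -/
lemma nearIntegerDens_reduce {x : ℝ} {f : ℕ → ℝ} (hf : Antitone f) (hf2 : ∀ q, f q ≤ 1 / 2)
    {k i : ℕ} (hk : k ∈ nearIntegerDens x f) (hi : i < roundGcd x k) :
    k - i * (k / roundGcd x k) ∈ nearIntegerDens x f ∧
      k - i * (k / roundGcd x k) = (roundGcd x k - i) * (k / roundGcd x k) ∧
      roundGcd x (k - i * (k / roundGcd x k)) = roundGcd x k - i := by
  obtain ⟨hk0, hkx⟩ := hk
  obtain ⟨h, hh⟩ : roundGcd x k ∣ k := Nat.gcd_dvd_left _ _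
  obtain ⟨n, hn⟩ : (roundGcd x k : ℤ) ∣ round (k * x) :=
    Int.natCast_dvd.2 (Nat.gcd_dvd_right _ _)
  set D := roundGcd x k with hD
  have hD0 : 0 < D := by omega
  have hdiv : k / D = h := by rw [hh]; exact Nat.mul_div_cancel_left h hD0
  rw [hdiv]
  have hsub : k - i * h = (D - i) * h := by rw [Nat.sub_mul, ← hh]
  have hh0 : 0 < h := Nat.pos_of_ne_zero (by rintro rfl; omega)
  have hcop : h.gcd n.natAbs = 1 := by
    have h1 : D = D * h.gcd n.natAbs := by
      conv_lhs => rw [hD, roundGcd, hn, hh, Int.natAbs_mul, Int.natAbs_natCast, Nat.gcd_mul_left]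
    exact Nat.eq_of_mul_eq_mul_left hD0 (by omega)
  have hDR : (0 : ℝ) < D := by exact_mod_cast hD0
  have hc : ((D - i : ℕ) : ℝ) ≤ D := by exact_mod_cast Nat.sub_le _ _
  have hkR : (k : ℝ) = D * h := by exact_mod_cast hh
  have hnR : (round (k * x) : ℝ) = D * n := by exact_mod_cast hn
  have habs : |(((D - i) * h : ℕ) : ℝ) * x - (((D - i : ℕ) * n : ℤ) : ℝ)|
      ≤ |k * x - round (k * x)| := by
    have e1 : (((D - i) * h : ℕ) : ℝ) * x - (((D - i : ℕ) * n : ℤ) : ℝ)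
        = (D - i : ℕ) * (h * x - n) := by push_cast; ring
    have e2 : (k : ℝ) * x - round (k * x) = D * (h * x - n) := by rw [hnR, hkR]; ring
    rw [e1, e2, abs_mul, abs_mul, Nat.abs_cast, Nat.abs_cast]
    gcongr
  have hround : round ((((D - i) * h : ℕ) : ℝ) * x) = (D - i : ℕ) * n :=
    round_eq_of_abs_sub_lt (habs.trans_lt (hkx.trans_le (hf2 k)))
  rw [hsub]
  refine ⟨⟨by have : 0 < D - i := by omega
              positivity, ?_⟩, rfl, ?_⟩
  · rw [hround]
    refine habs.trans_lt (hkx.trans_le (hf ?_))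
    rw [← hsub]; exact Nat.sub_le _ _
  · rw [roundGcd, hround, Int.natAbs_mul, Int.natAbs_natCast, Nat.gcd_mul_left, hcop, mul_one]

open Classical in
/-- Only a proportion `1 / j` of the weight is carried by denominators `k` for which `j` divides
both `k` and the integer nearest to `k x`. -/
lemma sum_dvd_roundGcd_le {x : ℝ} {f : ℕ → ℝ} (hf : Antitone f)
    (hf2 : ∀ q, f q ≤ 1 / 2) {w : ℕ → ℝ} (hw : Antitone w) (hw0 : ∀ q, 0 ≤ w q) (N j : ℕ) :
    j * ∑ k ∈ (Finset.range N).filter (fun k => k ∈ nearIntegerDens x f ∧ j ∣ roundGcd x k), w k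
      ≤ ∑ k ∈ (Finset.range N).filter (fun k => k ∈ nearIntegerDens x f), w k := by
  set A := (Finset.range N).filter (fun k => k ∈ nearIntegerDens x f ∧ j ∣ roundGcd x k)
  set B := (Finset.range N).filter (fun k => k ∈ nearIntegerDens x f)
  let φ : ℕ × ℕ → ℕ := fun p => p.1 - p.2 * (p.1 / roundGcd x p.1)
  have hA (p : ℕ × ℕ) (hp : p ∈ A ×ˢ Finset.range j) :
      p.1 < N ∧ p.1 ∈ nearIntegerDens x f ∧ j ∣ roundGcd x p.1 ∧ p.2 < j ∧
        p.2 < roundGcd x p.1 := by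
    simp only [A, Finset.mem_product, Finset.mem_filter, Finset.mem_range] at hp
    obtain ⟨⟨h1, h2, h3⟩, h4⟩ := hp
    refine ⟨h1, h2, h3, h4, h4.trans_le (Nat.le_of_dvd ?_ h3)⟩
    exact Nat.gcd_pos_of_pos_left _ h2.1
  -- The image `(D - i) h` determines `D - i` as its `roundGcd`, hence also `h`. As `j ∣ D` and `i <
  -- j`, `D` is the least multiple of `j` not below `D - i`. Each `k` thus owns `j` elements of `B`,
  -- none of smaller weight.
  have hinj : Set.InjOn φ (A ×ˢ Finset.range j : Finset (ℕ × ℕ)) := by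
    intro p hp q hq hpq
    obtain ⟨-, p1, ⟨c, pc⟩, p3, p4⟩ := hA p hp
    obtain ⟨-, q1, ⟨e, qe⟩, q3, q4⟩ := hA q hq
    obtain ⟨-, p5, p6⟩ := nearIntegerDens_reduce hf hf2 p1 p4
    obtain ⟨-, q5, q6⟩ := nearIntegerDens_reduce hf hf2 q1 q4
    simp only [φ] at hpq
    rw [hpq, q6] at p6
    rw [p5, q5, p6] at hpq
    have hDD : roundGcd x p.1 = roundGcd x q.1 := by
      have hce : c = e := by
        rw [pc, qe] at p6
        rw [pc] at p4
        rw [qe] at q4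
        rcases lt_trichotomy c e with h | h | h
        · have := Nat.mul_le_mul_left j (Nat.succ_le_of_lt h)
          rw [Nat.succ_eq_add_one, Nat.mul_add, mul_one] at this
          omega
        · exact h
        · have := Nat.mul_le_mul_left j (Nat.succ_le_of_lt h)
          rw [Nat.succ_eq_add_one, Nat.mul_add, mul_one] at this
          omega
      rw [pc, qe, hce]
    have h2 : p.2 = q.2 := by omega
    have hhh : p.1 / roundGcd x p.1 = q.1 / roundGcd x q.1 :=
      Nat.eq_of_mul_eq_mul_left (by omega) hpq
    have hp1 : roundGcd x p.1 * (p.1 / roundGcd x p.1) = p.1 :=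
      Nat.mul_div_cancel' (Nat.gcd_dvd_left _ _)
    have hq1 : roundGcd x q.1 * (q.1 / roundGcd x q.1) = q.1 :=
      Nat.mul_div_cancel' (Nat.gcd_dvd_left _ _)
    have h1 : p.1 = q.1 := by rw [← hp1, ← hq1, hhh, hDD]
    exact Prod.ext h1 h2
  calc (j : ℝ) * ∑ k ∈ A, w k = ∑ p ∈ A ×ˢ Finset.range j, w p.1 := by
        rw [Finset.sum_product]
        simp [Finset.mul_sum]
    _ ≤ ∑ p ∈ A ×ˢ Finset.range j, w (φ p) := by
        refine Finset.sum_le_sum fun p _ => hw (Nat.sub_le _ _)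
    _ = ∑ k ∈ (A ×ˢ Finset.range j).image φ, w k := (Finset.sum_image hinj).symm
    _ ≤ ∑ k ∈ B, w k := by
        refine Finset.sum_le_sum_of_subset_of_nonneg ?_ fun k _ _ => hw0 k
        intro k hk
        obtain ⟨p, hp, rfl⟩ := Finset.mem_image.1 hk
        obtain ⟨p0, p1, -, -, p4⟩ := hA p hp
        exact Finset.mem_filter.2 ⟨Finset.mem_range.2 ((Nat.sub_le _ _).trans_lt p0),
          (nearIntegerDens_reduce hf hf2 p1 p4).1⟩

/-- With `k = j g`, `l = j' g` and nearest integers `n`, `n'`, the integer `j n' - j' n` equals `j'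
(k x - n) - j (l x - n')`, of size at most `2 j f(l) < 1`. It vanishes, and `j` divides `n` by
coprimality with `j'`. -/
lemma div_gcd_dvd_roundGcd {x : ℝ} {f : ℕ → ℝ} (hf : Antitone f) {k l : ℕ}
    (hk : k ∈ nearIntegerDens x f) (hl : l ∈ nearIntegerDens x f) (hlk : l < k)
    (hbad : 2 * f l * k < k.gcd l) : k / k.gcd l ∣ roundGcd x k := by
  have hg : 0 < k.gcd l := Nat.gcd_pos_of_pos_left l hk.1
  obtain ⟨j, j', hcop, hkj, hlj⟩ := Nat.exists_coprime k l
  set g := k.gcd l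
  have hdiv : k / g = j := by conv_lhs => rw [hkj]; exact Nat.mul_div_cancel j hg
  rw [hdiv]
  have hgR : (0 : ℝ) < g := by exact_mod_cast hg
  have hkR : (k : ℝ) = j * g := by exact_mod_cast hkj
  have hlR : (l : ℝ) = j' * g := by exact_mod_cast hlj
  have hb : 2 * f l * j < 1 := by
    rw [hkR, ← mul_assoc] at hbad
    exact (mul_lt_iff_lt_one_left hgR).1 hbad
  have hj0 : 0 < j := Nat.pos_of_ne_zero (by rintro rfl; have := hk.1; omega)
  have hj0R : (0 : ℝ) < j := by exact_mod_cast hj0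
  have hjj : (j' : ℝ) ≤ j := by
    have : j' * g < j * g := by omega
    exact_mod_cast (Nat.lt_of_mul_lt_mul_right this).le
  have h1 := abs_lt.1 hk.2
  have h2 := abs_lt.1 hl.2
  have hfkl := hf hlk.le
  have hfl : 0 < f l := by linarith
  set n := round (k * x) with hn
  set n' := round (l * x)
  have hj'0 : (0 : ℝ) ≤ j' := by positivity
  have key : |((j * n' - j' * n : ℤ) : ℝ)| < 1 := by
    have e : ((j * n' - j' * n : ℤ) : ℝ) = j' * (k * x - n) - j * (l * x - n') := by
      push_cast; rw [hkR, hlR]; ring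
    rw [e]
    calc |(j' : ℝ) * (k * x - n) - j * (l * x - n')|
        ≤ |(j' : ℝ) * (k * x - n)| + |(j : ℝ) * (l * x - n')| := abs_sub _ _
      _ = j' * |k * x - n| + j * |l * x - n'| := by
          rw [abs_mul, abs_mul, Nat.abs_cast, Nat.abs_cast]
      _ ≤ j * f l + j * f l := by
          gcongr
          · exact hk.2.le.trans hfkl
          · exact hl.2.le
      _ < 1 := by linarith
  have hz : (j * n' - j' * n : ℤ) = 0 := by
    rw [← Int.abs_lt_one_iff]
    exact_mod_cast key
  have hdvd : (j : ℤ) ∣ n := by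
    have : (j : ℤ) ∣ j' * n := ⟨n', by linarith⟩
    exact (Int.isCoprime_iff_gcd_eq_one.2 (by simpa using hcop)).dvd_of_dvd_mul_left this
  exact Nat.dvd_gcd ⟨g, hkj⟩ (Int.natCast_dvd.1 hdvd)

-- At most `j` values `l < k` have `k / gcd(k, l) = j`, since they are multiples of `k / j`. They
-- contribute at most `j * j^(-m)`, and `m ≥ 2` brings this down to `1 / j`.
open Classical in
lemma sum_gcd_div_pow_le {m : ℕ} (hm : 2 ≤ m) {k : ℕ} (hk : 0 < k) {D : ℕ} (hD : D ≠ 0)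
    (s : Finset ℕ) (hs : ∀ l ∈ s, l < k ∧ k / k.gcd l ∣ D) :
    ∑ l ∈ s, ((k.gcd l : ℝ) / k) ^ m ≤ ∑ j ∈ D.divisors, (1 : ℝ) / j := by
  rw [← Finset.sum_fiberwise_of_maps_to (t := D.divisors) (g := fun l => k / k.gcd l)
    (fun l hl => Nat.mem_divisors.2 ⟨(hs l hl).2, hD⟩)]
  refine Finset.sum_le_sum fun j hj => ?_
  have hj0 : 0 < j := Nat.pos_of_mem_divisors hj
  have hj0R : (0 : ℝ) < j := by exact_mod_cast hj0
  have hkg (l : ℕ) (hl : k / k.gcd l = j) : k = j * k.gcd l := by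
    rw [← hl]; exact (Nat.div_mul_cancel (Nat.gcd_dvd_left k l)).symm
  have hterm : ∀ l ∈ s.filter (fun l => k / k.gcd l = j),
      ((k.gcd l : ℝ) / k) ^ m = (1 / (j : ℝ)) ^ m := by
    intro l hl
    have h := hkg l (Finset.mem_filter.1 hl).2
    have hg : (0 : ℝ) < k.gcd l := by exact_mod_cast Nat.gcd_pos_of_pos_left l hk
    congr 1
    have hR : (k : ℝ) = j * k.gcd l := by exact_mod_cast h
    rw [div_eq_div_iff (by positivity) hj0R.ne']
    linarith
  rw [Finset.sum_congr rfl hterm, Finset.sum_const, nsmul_eq_mul]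
  have hcard : (s.filter (fun l => k / k.gcd l = j)).card ≤ j := by
    conv_rhs => rw [← Finset.card_range j]
    apply Finset.card_le_card_of_injOn (fun l => l / k.gcd l)
    · intro l hl
      obtain ⟨h1, h2⟩ := Finset.mem_filter.1 hl
      simp only [Finset.coe_range, Set.mem_Iio]
      rw [Nat.div_lt_iff_lt_mul (Nat.gcd_pos_of_pos_left l hk), ← hkg l h2]
      exact (hs l h1).1
    · intro l hl l' hl' h
      have h1 := hkg l (Finset.mem_filter.1 hl).2
      have h2 := hkg l' (Finset.mem_filter.1 hl').2
      have h3 : k.gcd l = k.gcd l' := Nat.eq_of_mul_eq_mul_left hj0 (by rw [← h1, ← h2])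
      simp only at h
      rw [← Nat.div_mul_cancel (Nat.gcd_dvd_right k l), h, h3,
        Nat.div_mul_cancel (Nat.gcd_dvd_right k l')]
  calc ((s.filter (fun l => k / k.gcd l = j)).card : ℝ) * (1 / (j : ℝ)) ^ m
      ≤ j * (1 / (j : ℝ)) ^ 2 := by
        gcongr ?_ * ?_
        · exact_mod_cast hcard
        · apply pow_le_pow_of_le_one (by positivity) _ hm
          rw [div_le_one hj0R]; exact_mod_cast hj0
    _ = 1 / j := by field_simp

/-! ### Quasi-independence on average -/

/-- The overlap bound is at most twice the larger of its two terms; the condition compares `gcd(k,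
l) / k` with `2 * f l`. -/
lemma volume_real_torusNear_inter_le_of_lt {x : ℝ} {f : ℕ → ℝ} (hf0 : ∀ q, 0 < f q)
    (hf2 : ∀ q, f q ≤ 1 / 2) (m : ℕ) {k l : ℕ} (hk : k ∈ nearIntegerDens x f) :
    volume.real (torusNear m k (f k) ∩ torusNear m l (f l))
      ≤ 2 ^ m * ((2 * f k) ^ m * (2 * f l) ^ m) +
        if 2 * f l * k < k.gcd l then 2 ^ m * (2 * f k) ^ m * ((k.gcd l : ℝ) / k) ^ m else 0 := by
  have hkR : (0 : ℝ) < k := by exact_mod_cast hk.1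
  have ha := hf0 k
  have hb := hf0 l
  refine (volume_real_torusNear_inter_le m hk.1 ha (hf2 k) hb).trans ?_
  split_ifs with h
  · refine le_add_of_nonneg_of_le (by positivity) ?_
    rw [← mul_pow, ← mul_pow]
    gcongr
    have : 2 * f l ≤ k.gcd l / k := by rw [le_div_iff₀ hkR]; exact h.le
    calc 4 * f k * f l + 2 * f k * (k.gcd l) / k
        = 2 * f k * (2 * f l) + 2 * f k * (k.gcd l / k) := by ring
      _ ≤ 2 * f k * (k.gcd l / k) + 2 * f k * (k.gcd l / k) := by gcongr
      _ = 2 * (2 * f k) * (k.gcd l / k) := by ring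
  · rw [add_zero, ← mul_pow, ← mul_pow]
    gcongr
    have : (k.gcd l : ℝ) / k ≤ 2 * f l := by rw [div_le_iff₀ hkR]; exact not_lt.1 h
    calc 4 * f k * f l + 2 * f k * (k.gcd l) / k
        = 2 * f k * (2 * f l) + 2 * f k * (k.gcd l / k) := by ring
      _ ≤ 2 * f k * (2 * f l) + 2 * f k * (2 * f l) := by gcongr
      _ = 2 * (2 * f k * (2 * f l)) := by ring

lemma sum_sum_eq_two_mul_sum_lt {s : Finset ℕ} {w : ℕ → ℕ → ℝ} (hw : ∀ k l, w k l = w l k) :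
    ∑ k ∈ s, ∑ l ∈ s, w k l
      = 2 * ∑ k ∈ s, ∑ l ∈ s with l < k, w k l + ∑ k ∈ s, w k k := by
  have h1 : ∑ k ∈ s, ∑ l ∈ s, w k l = ∑ k ∈ s, ∑ l ∈ s with l < k, w k l
      + ∑ k ∈ s, ∑ l ∈ s with k < l, w k l + ∑ k ∈ s, w k k := by
    rw [← Finset.sum_add_distrib, ← Finset.sum_add_distrib]
    refine Finset.sum_congr rfl fun k hk => ?_
    have : w k k = ∑ l ∈ s, if l = k then w k l else 0 := by simp [hk]
    rw [Finset.sum_filter, Finset.sum_filter, this, ← Finset.sum_add_distrib,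
      ← Finset.sum_add_distrib]
    refine Finset.sum_congr rfl fun l _ => ?_
    rcases lt_trichotomy l k with h | h | h
    · simp [h, h.ne, h.le.not_gt]
    · simp [h]
    · simp [h, h.ne', h.le.not_gt]
  have h2 : ∑ k ∈ s, ∑ l ∈ s with k < l, w k l = ∑ k ∈ s, ∑ l ∈ s with l < k, w k l := by
    simp only [Finset.sum_filter]
    rw [Finset.sum_comm]
    simp only [hw]
  rw [h1, h2]; ring

-- After exchanging sums, `j` contributes `1 / j` times a mass of at most `S / j`, and `∑ 1 / j^2 ≤
-- 2`.
open Classical in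
lemma sum_mul_sum_divisors_roundGcd_le {x : ℝ} {f : ℕ → ℝ} (hf : Antitone f)
    (hf2 : ∀ q, f q ≤ 1 / 2) {w : ℕ → ℝ} (hw : Antitone w) (hw0 : ∀ q, 0 ≤ w q) (N : ℕ) :
    ∑ k ∈ (Finset.range N).filter (· ∈ nearIntegerDens x f),
        w k * ∑ j ∈ (roundGcd x k).divisors, (1 : ℝ) / j
      ≤ 2 * ∑ k ∈ (Finset.range N).filter (· ∈ nearIntegerDens x f), w k := by
  set B := (Finset.range N).filter (· ∈ nearIntegerDens x f) with hB
  set S := ∑ k ∈ B, w k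
  have hS : 0 ≤ S := Finset.sum_nonneg fun k _ => hw0 k
  have hdiv : ∀ k ∈ B, (roundGcd x k).divisors
      = (Finset.Ioo 0 N).filter (fun j => j ∣ roundGcd x k) := by
    intro k hk
    obtain ⟨h1, h2⟩ := Finset.mem_filter.1 hk
    have hk0 := h2.1
    have hkN := Finset.mem_range.1 h1
    have hD : 0 < roundGcd x k := Nat.gcd_pos_of_pos_left _ hk0
    have hDk : roundGcd x k ≤ k := Nat.le_of_dvd hk0 (Nat.gcd_dvd_left _ _)
    ext j
    simp only [Nat.mem_divisors, Finset.mem_filter, Finset.mem_Ioo]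
    constructor
    · rintro ⟨h, -⟩
      have := Nat.le_of_dvd hD h
      exact ⟨⟨Nat.pos_of_dvd_of_pos h hD, by omega⟩, h⟩
    · rintro ⟨-, h⟩
      exact ⟨h, hD.ne'⟩
  calc ∑ k ∈ B, w k * ∑ j ∈ (roundGcd x k).divisors, (1 : ℝ) / j
      = ∑ k ∈ B, ∑ j ∈ Finset.Ioo 0 N, if j ∣ roundGcd x k then 1 / (j : ℝ) * w k else 0 := by
        refine Finset.sum_congr rfl fun k hk => ?_
        rw [hdiv k hk, Finset.mul_sum, Finset.sum_filter]
        refine Finset.sum_congr rfl fun j _ => ?_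
        rw [mul_comm]
    _ = ∑ j ∈ Finset.Ioo 0 N, 1 / (j : ℝ) * ∑ k ∈ (Finset.range N).filter
          (fun k => k ∈ nearIntegerDens x f ∧ j ∣ roundGcd x k), w k := by
        rw [Finset.sum_comm]
        refine Finset.sum_congr rfl fun j _ => ?_
        rw [← Finset.sum_filter, Finset.mul_sum, hB, Finset.filter_filter]
    _ ≤ ∑ j ∈ Finset.Ioo 0 N, ((j : ℝ) ^ 2)⁻¹ * S := by
        refine Finset.sum_le_sum fun j hj => ?_
        have hj0 : (0 : ℝ) < j := by exact_mod_cast (Finset.mem_Ioo.1 hj).1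
        have h := sum_dvd_roundGcd_le (x := x) hf hf2 hw hw0 N j
        rw [← le_div_iff₀' hj0] at h
        calc _ ≤ 1 / (j : ℝ) * (S / j) := by gcongr
          _ = _ := by field_simp
    _ ≤ 2 * S := by
        rw [← Finset.sum_mul]
        gcongr
        simpa using sum_Ioo_inv_sq_le (α := ℝ) 0 N

open Classical in
lemma sum_volume_torusNear_inter_le {x : ℝ} {f : ℕ → ℝ} (hf : Antitone f) (hf0 : ∀ q, 0 < f q)
    (hf2 : ∀ q, f q ≤ 1 / 2) {m : ℕ} (hm : 2 ≤ m) (N : ℕ)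
    (hS : 1 ≤ ∑ k ∈ (Finset.range N).filter (· ∈ nearIntegerDens x f), (2 * f k) ^ m) :
    ∑ k ∈ (Finset.range N).filter (· ∈ nearIntegerDens x f),
      ∑ l ∈ (Finset.range N).filter (· ∈ nearIntegerDens x f),
        volume.real (torusNear m k (f k) ∩ torusNear m l (f l))
      ≤ 7 * 2 ^ m *
        (∑ k ∈ (Finset.range N).filter (· ∈ nearIntegerDens x f), (2 * f k) ^ m) ^ 2 := by
  set B := (Finset.range N).filter (· ∈ nearIntegerDens x f) with hB
  set S := ∑ k ∈ B, (2 * f k) ^ m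
  have hmem : ∀ k ∈ B, k ∈ nearIntegerDens x f := fun k hk => (Finset.mem_filter.1 hk).2
  have hw : Antitone fun q => (2 * f q) ^ m := fun p q h => by
    have := hf h
    have := hf0 q
    dsimp only
    gcongr
  have hoff : ∑ k ∈ B, ∑ l ∈ B with l < k,
      volume.real (torusNear m k (f k) ∩ torusNear m l (f l))
      ≤ 2 ^ m * S ^ 2 + 2 ^ m * (2 * S) := by
    calc _ ≤ ∑ k ∈ B, (2 ^ m * ((2 * f k) ^ m * S) +
          2 ^ m * ((2 * f k) ^ m * ∑ j ∈ (roundGcd x k).divisors, (1 : ℝ) / j)) := by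
          refine Finset.sum_le_sum fun k hk => ?_
          have hkm := hmem k hk
          have hfk := hf0 k
          calc _ ≤ ∑ l ∈ B with l < k, (2 ^ m * ((2 * f k) ^ m * (2 * f l) ^ m) +
                if 2 * f l * k < k.gcd l then
                  2 ^ m * (2 * f k) ^ m * ((k.gcd l : ℝ) / k) ^ m else 0) :=
                Finset.sum_le_sum fun l _ =>
                  volume_real_torusNear_inter_le_of_lt hf0 hf2 m hkm
            _ ≤ _ := by
                rw [Finset.sum_add_distrib]
                gcongr
                · rw [← Finset.mul_sum, ← Finset.mul_sum]
                  gcongr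
                  refine Finset.sum_le_sum_of_subset_of_nonneg (Finset.filter_subset _ _) ?_
                  intro l _ _
                  have := hf0 l
                  positivity
                · rw [← Finset.sum_filter, ← Finset.mul_sum, mul_assoc]
                  gcongr
                  refine sum_gcd_div_pow_le hm hkm.1 (Nat.gcd_pos_of_pos_left _ hkm.1).ne' _ ?_
                  intro l hl
                  obtain ⟨hl1, hl2⟩ := Finset.mem_filter.1 hl
                  obtain ⟨hl3, hl4⟩ := Finset.mem_filter.1 hl1
                  exact ⟨hl4, div_gcd_dvd_roundGcd hf hkm (hmem l hl3) hl4 hl2⟩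
      _ = 2 ^ m * S ^ 2 + 2 ^ m * ∑ k ∈ B,
            ((2 * f k) ^ m * ∑ j ∈ (roundGcd x k).divisors, (1 : ℝ) / j) := by
          rw [Finset.sum_add_distrib, ← Finset.mul_sum, ← Finset.mul_sum, ← Finset.sum_mul, sq]
      _ ≤ _ := by
          gcongr
          exact sum_mul_sum_divisors_roundGcd_le hf hf2 hw
            (fun q => by have := hf0 q; positivity) N
  have hdiag : ∑ k ∈ B, volume.real (torusNear m k (f k) ∩ torusNear m k (f k)) = S := by
    refine Finset.sum_congr rfl fun k hk => ?_
    rw [Set.inter_self, volume_real_torusNear m (hmem k hk).1 (hf0 k) (hf2 k)]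
  rw [sum_sum_eq_two_mul_sum_lt fun k l => by rw [Set.inter_comm], hdiag]
  have h2m : (1 : ℝ) ≤ 2 ^ m := one_le_pow₀ (by norm_num)
  -- Using `S ≥ 1`, the constant `7` is `2 * (1 + 2)` from the off-diagonal pairs plus `1` from the
  -- diagonal.
  have hSS : S ≤ S ^ 2 := by nlinarith
  have h3 : S ≤ 2 ^ m * S ^ 2 := by nlinarith
  have h4 : (2 : ℝ) ^ m * S ≤ 2 ^ m * S ^ 2 := by gcongr
  linarith

open Classical in
theorem volume_frequently_torusNear_pos {x : ℝ} {f : ℕ → ℝ} (hf : Antitone f)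
    (hf0 : ∀ q, 0 < f q) (hf2 : ∀ q, f q ≤ 1 / 2) {m : ℕ} (hm : 2 ≤ m)
    (hdiv : ¬ Summable ((nearIntegerDens x f).indicator fun q => f q ^ m)) :
    0 < volume {y : Fin m → UnitAddCircle |
      ∃ᶠ q in Filter.atTop, q ∈ nearIntegerDens x f ∧ y ∈ torusNear m q (f q)} := by
  let B : ℕ → Finset ℕ := fun N => (Finset.range N).filter (· ∈ nearIntegerDens x f)
  let S : ℕ → ℝ := fun N => ∑ k ∈ B N, (2 * f k) ^ m
  let E : ℕ → Set (Fin m → UnitAddCircle) := fun q =>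
    {y | q ∈ nearIntegerDens x f ∧ y ∈ torusNear m q (f q)}
  have hEB (q : ℕ) (hq : q ∈ nearIntegerDens x f) : E q = torusNear m q (f q) := by
    ext y; simp [E, hq]
  have hEm (q : ℕ) : MeasurableSet (E q) := by
    by_cases hq : q ∈ nearIntegerDens x f
    · rw [hEB q hq]; exact measurableSet_torusNear m q _
    · have : E q = ∅ := by ext y; simp [E, hq]
      rw [this]; exact MeasurableSet.empty
  have htend : Filter.Tendsto S Filter.atTop Filter.atTop := by
    have h1 := (not_summable_iff_tendsto_nat_atTop_of_nonneg (fun q =>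
      Set.indicator_nonneg (fun q _ => by have := hf0 q; positivity) q)).1 hdiv
    have h2 := h1.const_mul_atTop (show (0 : ℝ) < 2 ^ m by positivity)
    refine h2.congr fun N => ?_
    simp only [S, B, Set.indicator_apply]
    rw [← Finset.sum_filter, Finset.mul_sum]
    simp only [mul_pow]
  refine measure_frequently_pos hEm (c := 1 / (4 * (7 * 2 ^ m))) (by positivity) fun M => ?_
  -- At least half of `S N` then comes from indices `≥ M`; squaring this half accounts for the `4`
  -- in `c`.
  obtain ⟨N, hN1, hN2⟩ := ((htend.eventually_ge_atTop (2 * S M + 1)).and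
    (Filter.eventually_ge_atTop M)).exists
  have hSM : 0 ≤ S M := Finset.sum_nonneg fun k _ => by have := hf0 k; positivity
  have hsub : B M ⊆ B N := Finset.filter_subset_filter _ (Finset.range_mono hN2)
  have hmem : ∀ k ∈ B N, k ∈ nearIntegerDens x f := fun k hk => (Finset.mem_filter.1 hk).2
  have hSF : ∑ q ∈ B N \ B M, volume.real (E q) = S N - S M := by
    have h : S N = ∑ q ∈ B N \ B M, (2 * f q) ^ m + S M := (Finset.sum_sdiff hsub).symm
    rw [h, add_sub_cancel_right]
    refine Finset.sum_congr rfl fun q hq => ?_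
    have hq' := hmem q (Finset.mem_sdiff.1 hq).1
    rw [hEB q hq', volume_real_torusNear m hq'.1 (hf0 q) (hf2 q)]
  have hQ : ∑ k ∈ B N \ B M, ∑ l ∈ B N \ B M, volume.real (E k ∩ E l) ≤ 7 * 2 ^ m * S N ^ 2 := by
    refine le_trans ?_ (sum_volume_torusNear_inter_le hf hf0 hf2 hm N
      (show 1 ≤ S N by linarith))
    refine le_trans (Finset.sum_le_sum_of_subset_of_nonneg Finset.sdiff_subset
      fun k _ _ => Finset.sum_nonneg fun l _ => measureReal_nonneg) ?_
    refine Finset.sum_le_sum fun k hk => ?_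
    refine le_trans (Finset.sum_le_sum_of_subset_of_nonneg Finset.sdiff_subset
      fun l _ _ => measureReal_nonneg) ?_
    refine Finset.sum_le_sum fun l hl => ?_
    rw [hEB k (hmem k hk), hEB l (hmem l hl)]
  refine ⟨B N \ B M, fun q hq => ?_, measureReal_biUnion_ge _ hEm (by positivity) ?_ ?_⟩
  · obtain ⟨h1, h2⟩ := Finset.mem_sdiff.1 hq
    by_contra! h
    exact h2 (Finset.mem_filter.2 ⟨Finset.mem_range.2 h, hmem q h1⟩)
  · rw [hSF]; linarith
  · rw [hSF]
    refine hQ.trans ?_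
    have : S N ^ 2 ≤ 4 * (S N - S M) ^ 2 := by nlinarith
    calc 7 * 2 ^ m * S N ^ 2 ≤ 7 * 2 ^ m * (4 * (S N - S M) ^ 2) := by gcongr
      _ = _ := by ring

/-! ### From positive to full measure by ergodicity of doubling -/

/-- The points killed by some power of the doubling map are the dyadic ones, which are dense. -/
lemma torus_ergodic_two_nsmul (m : ℕ) :
    Ergodic (fun y : Fin m → UnitAddCircle => 2 • y) volume := by
  let φ : (Fin m → UnitAddCircle) →+ (Fin m → UnitAddCircle) := nsmulAddMonoidHom 2
  have hiter (n : ℕ) (y : Fin m → UnitAddCircle) : φ^[n] y = 2 ^ n • y := by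
    induction n with
    | zero => simp
    | succ n ih => rw [Function.iterate_succ_apply', ih, pow_succ', mul_smul]; rfl
  refine AddMonoidHom.ergodic_of_dense_iUnion_preimage_zero φ ?_ (continuous_nsmul 2) ?_
  · intro y
    have hrep : ∀ i, ∃ w : ℝ, (w : UnitAddCircle) = y i := fun i => QuotientAddGroup.mk_surjective _
    choose w hw using hrep
    have hlim : Filter.Tendsto (fun (n : ℕ) (i : Fin m) =>
        ((⌊(2 : ℝ) ^ n * w i⌋ / 2 ^ n : ℝ) : UnitAddCircle)) Filter.atTop (nhds y) := by
      rw [tendsto_pi_nhds]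
      intro i
      rw [← hw i]
      refine ((AddCircle.continuous_mk' (1 : ℝ)).tendsto _).comp ?_
      rw [tendsto_iff_dist_tendsto_zero]
      refine squeeze_zero (fun _ => dist_nonneg) (g := fun n => (1 / 2 : ℝ) ^ n) (fun n => ?_)
        (tendsto_pow_atTop_nhds_zero_of_lt_one (by norm_num) (by norm_num))
      have h2 : (0 : ℝ) < 2 ^ n := by positivity
      have e : (⌊(2 : ℝ) ^ n * w i⌋ / 2 ^ n : ℝ) - w i = -(Int.fract ((2 : ℝ) ^ n * w i) / 2 ^ n) := by
        rw [Int.fract]; field_simp; ring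
      rw [Real.dist_eq, e, abs_neg, abs_of_nonneg (div_nonneg (Int.fract_nonneg _) h2.le),
        one_div_pow]
      gcongr
      exact (Int.fract_lt_one _).le
    refine mem_closure_of_tendsto hlim (Filter.Eventually.of_forall fun n => ?_)
    refine Set.mem_iUnion.2 ⟨n, ?_⟩
    rw [Set.mem_preimage, hiter]
    change _ = 0
    ext i
    have h2 : (2 : ℝ) ^ n ≠ 0 := by positivity
    rw [Pi.smul_apply, ← AddCircle.coe_nsmul, nsmul_eq_mul]
    push_cast
    rw [mul_div_cancel₀ _ h2]
    exact (AddCircle.coe_eq_zero_iff 1).2 ⟨⌊(2 : ℝ) ^ n * w i⌋, by simp⟩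
  · intro y
    choose w hw using fun i => QuotientAddGroup.mk_surjective (y i)
    refine ⟨fun i => ((w i / 2 : ℝ) : UnitAddCircle), ?_⟩
    ext i
    change 2 • ((w i / 2 : ℝ) : UnitAddCircle) = y i
    rw [← AddCircle.coe_nsmul, nsmul_eq_mul, Nat.cast_ofNat, mul_div_cancel₀ _ two_ne_zero]
    exact hw i

lemma measurableSet_frequently_torusNear (B : Set ℕ) (m : ℕ) (g : ℕ → ℝ) :
    MeasurableSet {y : Fin m → UnitAddCircle |
      ∃ᶠ q in Filter.atTop, q ∈ B ∧ y ∈ torusNear m q (g q)} := by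
  have : {y : Fin m → UnitAddCircle | ∃ᶠ q in Filter.atTop, q ∈ B ∧ y ∈ torusNear m q (g q)}
      = ⋂ M : ℕ, ⋃ q ≥ M, ⋃ (_ : q ∈ B), torusNear m q (g q) := by
    ext y
    simp [Filter.frequently_atTop, and_left_comm]
  rw [this]
  exact .iInter fun M => .iUnion fun q => .iUnion fun _ => .iUnion fun _ =>
    measurableSet_torusNear m q _

lemma two_nsmul_mem_torusNear {m q : ℕ} {a : ℝ} {y : Fin m → UnitAddCircle}
    (h : y ∈ torusNear m q a) : 2 • y ∈ torusNear m q (2 * a) := by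
  intro i
  have e : q • (2 • y) i = q • y i + q • y i := by
    rw [two_nsmul, Pi.add_apply, smul_add]
  rw [e, two_mul]
  exact (norm_add_le _ _).trans_lt (add_lt_add (h i) (h i))

/-- Doubling `y` doubles the radius, so `W c` is sent into `W (2 * c)`: no single `W c` need be
invariant, but their union is. -/
theorem ae_frequently_torusNear {x : ℝ} {f : ℕ → ℝ} (hf : Antitone f)
    (hf0 : ∀ q, 0 < f q) (hf2 : ∀ q, f q ≤ 1 / 2) {m : ℕ} (hm : 2 ≤ m)
    (hdiv : ¬ Summable ((nearIntegerDens x f).indicator fun q => f q ^ m)) :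
    ∀ᵐ y : Fin m → UnitAddCircle, ∃ c : ℕ,
      ∃ᶠ q in Filter.atTop, q ∈ nearIntegerDens x f ∧ y ∈ torusNear m q (c * f q) := by
  let W : ℕ → Set (Fin m → UnitAddCircle) := fun c => {y |
    ∃ᶠ q in Filter.atTop, q ∈ nearIntegerDens x f ∧ y ∈ torusNear m q (c * f q)}
  have hV : MeasurableSet (⋃ c, W c) :=
    .iUnion fun c => measurableSet_frequently_torusNear _ m _
  have hsub : (⋃ c, W c) ⊆ (fun y => 2 • y) ⁻¹' (⋃ c, W c) := by
    intro y hy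
    obtain ⟨c, hc⟩ := Set.mem_iUnion.1 hy
    refine Set.mem_iUnion.2 ⟨2 * c, Filter.Frequently.mono hc fun q hq => ⟨hq.1, ?_⟩⟩
    have h := two_nsmul_mem_torusNear hq.2
    rwa [← mul_assoc, ← Nat.cast_ofNat (R := ℝ) (n := 2), ← Nat.cast_mul] at h
  have hpos : 0 < volume (⋃ c, W c) := by
    refine (volume_frequently_torusNear_pos hf hf0 hf2 hm hdiv).trans_le
      (measure_mono fun y hy => Set.mem_iUnion.2 ⟨1, ?_⟩)
    simpa [W] using hy
  rcases (torus_ergodic_two_nsmul m).ae_empty_or_univ_of_ae_le_preimage hV.nullMeasurableSet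
    (Filter.Eventually.of_forall hsub) with h | h
  · rw [measure_congr h, measure_empty] at hpos
    exact absurd hpos (lt_irrefl _)
  · filter_upwards [Filter.eventuallyEq_univ.1 h] with y hy
    exact Set.mem_iUnion.1 hy

lemma ae_real_of_ae_torus {m : ℕ} {p : (Fin m → UnitAddCircle) → Prop} (h : ∀ᵐ y, p y) :
    ∀ᵐ y : Fin m → ℝ, p fun i => (y i : UnitAddCircle) := by
  have hcover : (⋃ v : Fin m → ℤ, Set.univ.pi fun i => Set.Ioc (v i : ℝ) (v i + 1)) = Set.univ := by
    rw [Set.eq_univ_iff_forall]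
    intro y
    refine Set.mem_iUnion.2 ⟨fun i => ⌈y i⌉ - 1, fun i _ => ?_⟩
    have h1 := Int.ceil_lt_add_one (y i)
    have h2 := Int.le_ceil (y i)
    push_cast
    constructor <;> linarith
  rw [← Measure.restrict_univ (μ := (volume : Measure (Fin m → ℝ))), ← hcover,
    ae_restrict_iUnion_iff]
  intro v
  have hmp := measurePreserving_pi (fun i => volume.restrict (Set.Ioc (v i : ℝ) (v i + 1)))
    (fun _ : Fin m => (volume : Measure UnitAddCircle))
    (fun i => AddCircle.measurePreserving_mk 1 (v i : ℝ))
  rw [volume_pi, Measure.restrict_pi_pi]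
  exact hmp.quasiMeasurePreserving.ae h

/-! ### Divergence of the series along the denominators near integers -/

open Classical in
/-- A quantitative form of Dirichlet's theorem, by the pigeonhole principle. -/
lemma card_near_integer_ge (x : ℝ) (N : ℕ) {ε : ℝ} (hε : 0 < ε) (hε1 : ε ≤ 1) :
    N * ε / 2 - 1 ≤
      (((Finset.Icc 1 N).filter fun q : ℕ => |q * x - round (q * x)| < ε).card : ℝ) := by
  set M := ⌈1 / ε⌉₊ with hM
  have hM1 : 1 / ε ≤ M := Nat.le_ceil _
  have hM0 : (0 : ℝ) < M := lt_of_lt_of_le (by positivity) hM1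
  have hM2 : (M : ℝ) ≤ 2 / ε := by
    have h1 := Nat.ceil_lt_add_one (show 0 ≤ 1 / ε by positivity)
    have h2 : 1 ≤ 1 / ε := by rw [le_div_iff₀ hε]; linarith
    have h3 : 2 / ε = 1 / ε + 1 / ε := by ring
    linarith
  let φ : ℕ → ℕ := fun i => ⌊M * Int.fract (i * x)⌋₊
  have hmaps : ∀ i ∈ Finset.range (N + 1), φ i ∈ Finset.range M := by
    intro i _
    rw [Finset.mem_range, Nat.floor_lt (mul_nonneg hM0.le (Int.fract_nonneg _))]
    have := Int.fract_lt_one ((i : ℝ) * x)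
    nlinarith
  obtain ⟨b, -, hb⟩ := Finset.exists_le_card_fiber_of_nsmul_le_card_of_maps_to (M := ℝ)
    (b := (N + 1 : ℝ) / M) hmaps
    ⟨0, Finset.mem_range.2 (by exact_mod_cast hM0)⟩ (by
      rw [Finset.card_range, Finset.card_range, nsmul_eq_mul, mul_div_cancel₀ _ hM0.ne']
      push_cast; rfl)
  set F := (Finset.range (N + 1)).filter fun i => φ i = b
  have hFne : F.Nonempty := by
    rw [← Finset.card_pos]
    have : (0 : ℝ) < (N + 1 : ℝ) / M := by positivity
    exact_mod_cast this.trans_le hb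
  set i₀ := F.min' hFne
  have hi₀ : i₀ ∈ F := F.min'_mem hFne
  -- Differences with the least index `i₀` of a crowded box are the required denominators. Dropping
  -- `i₀` itself costs the `- 1`.
  have hcard : (F.erase i₀).card ≤
      ((Finset.Icc 1 N).filter fun q : ℕ => |q * x - round (q * x)| < ε).card := by
    apply Finset.card_le_card_of_injOn (fun i => i - i₀)
    · intro i hi
      obtain ⟨hne, hiF⟩ := Finset.mem_erase.1 hi
      have hle : i₀ ≤ i := F.min'_le i hiF
      obtain ⟨h1, h2⟩ := Finset.mem_filter.1 hiF
      obtain ⟨-, h4⟩ := Finset.mem_filter.1 hi₀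
      rw [Finset.mem_range] at h1
      refine Finset.mem_coe.2 (Finset.mem_filter.2 ⟨Finset.mem_Icc.2 ?_, ?_⟩)
      · change 1 ≤ i - i₀ ∧ i - i₀ ≤ N
        omega
      refine (round_le _ (⌊i * x⌋ - ⌊i₀ * x⌋)).trans_lt ?_
      have e : ((i - i₀ : ℕ) : ℝ) * x - ((⌊i * x⌋ - ⌊i₀ * x⌋ : ℤ) : ℝ)
          = Int.fract (i * x) - Int.fract (i₀ * x) := by
        rw [Nat.cast_sub hle, Int.fract, Int.fract]; push_cast; ring
      rw [e]
      have a1 := Nat.floor_le (mul_nonneg hM0.le (Int.fract_nonneg ((i : ℝ) * x)))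
      have a2 := Nat.lt_floor_add_one ((M : ℝ) * Int.fract ((i : ℝ) * x))
      have a3 := Nat.floor_le (mul_nonneg hM0.le (Int.fract_nonneg ((i₀ : ℝ) * x)))
      have a4 := Nat.lt_floor_add_one ((M : ℝ) * Int.fract ((i₀ : ℝ) * x))
      simp only [φ] at h2 h4
      rw [h2] at a1 a2
      rw [h4] at a3 a4
      have hMε : 1 ≤ M * ε := by rwa [div_le_iff₀ hε] at hM1
      rw [abs_lt]
      constructor <;> nlinarith
    · intro i hi j hj hij
      have h1 : i₀ ≤ i := F.min'_le i (Finset.mem_erase.1 hi).2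
      have h2 : i₀ ≤ j := F.min'_le j (Finset.mem_erase.1 hj).2
      simp only at hij
      omega
  have hce : ((F.erase i₀).card : ℝ) = F.card - 1 := by
    rw [Finset.card_erase_of_mem hi₀, Nat.cast_sub (Finset.card_pos.2 hFne), Nat.cast_one]
  have hfin : (N : ℝ) * ε / 2 ≤ (N + 1 : ℝ) / M := by
    rw [le_div_iff₀ hM0]
    calc (N : ℝ) * ε / 2 * M ≤ N * ε / 2 * (2 / ε) := by gcongr
      _ = N := by field_simp
      _ ≤ N + 1 := by linarith
  calc (N : ℝ) * ε / 2 - 1 ≤ F.card - 1 := by linarith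
    _ = ((F.erase i₀).card : ℝ) := hce.symm
    _ ≤ _ := by exact_mod_cast hcard

/-- Since `(1 - θ) * a j ≤ a j - a (j + 1)`, the sum telescopes from the first admissible `j`. -/
lemma sum_Ico_filter_le_of_geometric {a : ℕ → ℝ} {b θ : ℝ} (ha : ∀ j, 0 ≤ a j) (hb : 0 ≤ b)
    (hθ : θ < 1) {J₀ J q : ℕ} (hgeo : ∀ j ≥ J₀, a (j + 1) ≤ θ * a j)
    (hab : ∀ j, q ≤ 2 ^ j → a j ≤ b) :
    ∑ j ∈ Finset.Ico J₀ J with q ≤ 2 ^ j, a j ≤ b / (1 - θ) := by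
  have hθ' : 0 < 1 - θ := by linarith
  set j₁ := max J₀ (Nat.clog 2 q)
  have heq : (Finset.Ico J₀ J).filter (fun j => q ≤ 2 ^ j) = Finset.Ico j₁ J := by
    ext j
    simp only [Finset.mem_filter, Finset.mem_Ico, j₁, max_le_iff,
      ← Nat.clog_le_iff_le_pow one_lt_two]
    tauto
  rw [heq, le_div_iff₀ hθ']
  rcases le_or_gt j₁ J with h | h
  · calc (∑ j ∈ Finset.Ico j₁ J, a j) * (1 - θ) ≤ ∑ j ∈ Finset.Ico j₁ J, (a j - a (j + 1)) := by
          rw [Finset.sum_mul]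
          refine Finset.sum_le_sum fun j hj => ?_
          have := hgeo j ((le_max_left _ _).trans (Finset.mem_Ico.1 hj).1)
          linarith
      _ = a j₁ - a J := by
          rw [← neg_inj, ← Finset.sum_neg_distrib]
          simp only [neg_sub]
          exact Finset.sum_Ico_sub _ h
      _ ≤ b := by
          have h1 := hab j₁ ((Nat.clog_le_iff_le_pow one_lt_two).1 (le_max_right _ _))
          have h2 := ha J
          linarith
  · rw [Finset.Ico_eq_empty_of_le h.le]
    simpa using hb

-- Dirichlet with `ε = f (2^j)` gives at least `2^j * f (2^j) / 4` elements of `B` up to `2^j`,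
-- `hbig` absorbing the `- 1`. Weighting by `f (2^j) ^ m` and summing over `j` counts each `q ∈ B`
-- at every `j` with `q ≤ 2^j`; geometric decay keeps its total below `f q ^ m / (1 - θ)`.
open Classical in
theorem not_summable_indicator_nearIntegerDens (x : ℝ) {f : ℕ → ℝ} (hf : Antitone f)
    (hf0 : ∀ q, 0 < f q) (hf2 : ∀ q, f q ≤ 1 / 2) {m : ℕ} {θ : ℝ} (hθ : θ < 1) {J₀ : ℕ}
    (hgeo : ∀ j ≥ J₀, f (2 ^ (j + 1)) ^ m ≤ θ * f (2 ^ j) ^ m)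
    (hbig : ∀ j ≥ J₀, 4 ≤ 2 ^ j * f (2 ^ j))
    (hdiv : ¬ Summable fun j : ℕ => (2 : ℝ) ^ j * f (2 ^ j) ^ (m + 1)) :
    ¬ Summable ((nearIntegerDens x f).indicator fun q => f q ^ m) := by
  intro hsum
  apply hdiv
  have hnn : ∀ q, 0 ≤ (nearIntegerDens x f).indicator (fun q => f q ^ m) q := fun q =>
    Set.indicator_nonneg (fun q _ => by have := hf0 q; positivity) q
  set T := ∑' q, (nearIntegerDens x f).indicator (fun q => f q ^ m) q
  have hθ' : 0 < 1 - θ := by linarith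
  let a : ℕ → ℝ := fun j => f (2 ^ j) ^ m
  have ha : ∀ j, 0 ≤ a j := fun j => by have := hf0 (2 ^ j); positivity
  let B : Finset ℕ → Finset ℕ := fun s => s.filter (· ∈ nearIntegerDens x f)
  have hterm : ∀ j ≥ J₀, (2 : ℝ) ^ j * f (2 ^ j) ^ (m + 1)
      ≤ 4 * (a j * (B (Finset.Icc 1 (2 ^ j))).card) := by
    intro j hj
    have h1 := card_near_integer_ge x (2 ^ j) (hf0 (2 ^ j)) ((hf2 _).trans (by norm_num))
    have h2 := hbig j hj
    have h3 : (((Finset.Icc 1 (2 ^ j)).filter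
        fun q : ℕ => |q * x - round (q * x)| < f (2 ^ j)).card : ℝ)
        ≤ (B (Finset.Icc 1 (2 ^ j))).card := by
      norm_cast
      refine Finset.card_le_card fun q hq => ?_
      obtain ⟨h1, h2⟩ := Finset.mem_filter.1 hq
      obtain ⟨h3, h4⟩ := Finset.mem_Icc.1 h1
      exact Finset.mem_filter.2 ⟨h1, h3, h2.trans_le (hf h4)⟩
    push_cast at h1
    have h4 : (2 : ℝ) ^ j * f (2 ^ j) ≤ 4 * (B (Finset.Icc 1 (2 ^ j))).card := by linarith
    calc (2 : ℝ) ^ j * f (2 ^ j) ^ (m + 1) = a j * (2 ^ j * f (2 ^ j)) := by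
          simp only [a]; ring
      _ ≤ a j * (4 * (B (Finset.Icc 1 (2 ^ j))).card) := by gcongr; exact ha j
      _ = _ := by ring
  have hpartial (J : ℕ) : ∑ j ∈ Finset.Ico J₀ J, (2 : ℝ) ^ j * f (2 ^ j) ^ (m + 1)
      ≤ 4 * (T / (1 - θ)) := by
    have hcount : ∀ j ∈ Finset.Ico J₀ J, a j * (B (Finset.Icc 1 (2 ^ j))).card
        = ∑ q ∈ B (Finset.Icc 1 (2 ^ J)), if q ≤ 2 ^ j then a j else 0 := by
      intro j hj
      have hjJ : 2 ^ j ≤ 2 ^ J := Nat.pow_le_pow_right two_pos (Finset.mem_Ico.1 hj).2.le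
      rw [← Finset.sum_filter, Finset.sum_const, nsmul_eq_mul, mul_comm]
      congr 3
      ext q
      simp only [B, Finset.mem_filter, Finset.mem_Icc]
      constructor
      · rintro ⟨⟨h1, h2⟩, h3⟩
        exact ⟨⟨⟨h1, h2.trans hjJ⟩, h3⟩, h2⟩
      · rintro ⟨⟨⟨h1, -⟩, h3⟩, h2⟩
        exact ⟨⟨h1, h2⟩, h3⟩
    calc ∑ j ∈ Finset.Ico J₀ J, (2 : ℝ) ^ j * f (2 ^ j) ^ (m + 1)
        ≤ ∑ j ∈ Finset.Ico J₀ J, 4 * (a j * (B (Finset.Icc 1 (2 ^ j))).card) :=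
          Finset.sum_le_sum fun j hj => hterm j (Finset.mem_Ico.1 hj).1
      _ = 4 * ∑ q ∈ B (Finset.Icc 1 (2 ^ J)), ∑ j ∈ Finset.Ico J₀ J with q ≤ 2 ^ j, a j := by
          rw [← Finset.mul_sum, Finset.sum_congr rfl hcount, Finset.sum_comm]
          simp only [Finset.sum_filter]
      _ ≤ 4 * ∑ q ∈ B (Finset.Icc 1 (2 ^ J)), f q ^ m / (1 - θ) := by
          gcongr with q hq
          have := hf0 q
          refine sum_Ico_filter_le_of_geometric ha (by positivity) hθ hgeo fun j hqj => ?_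
          have h1 := hf hqj
          have h2 := hf0 (2 ^ j)
          simp only [a]
          gcongr
      _ ≤ 4 * (T / (1 - θ)) := by
          rw [← Finset.sum_div]
          gcongr
          rw [Finset.sum_filter]
          refine le_trans (le_of_eq ?_) (hsum.sum_le_tsum (Finset.Icc 1 (2 ^ J)) fun q _ => hnn q)
          simp [Set.indicator_apply]
  rw [← summable_nat_add_iff J₀]
  refine summable_of_sum_range_le (c := 4 * (T / (1 - θ))) (fun j => ?_) fun n => ?_
  · have := hf0 (2 ^ (j + J₀))
    positivity
  · have h := hpartial (J₀ + n)
    rw [Finset.sum_Ico_eq_sum_range, Nat.add_sub_cancel_left] at h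
    simpa [add_comm] using h
-- Iterated logarithms and their products
open Filter Topology

lemma Real.tendsto_log_iterate_atTop (i : ℕ) : Tendsto (Real.log^[i]) atTop atTop := by
  induction i with
  | zero => exact tendsto_id
  | succ i ih =>
    rw [Function.iterate_succ']
    exact Real.tendsto_log_atTop.comp ih

lemma Real.log_iterate_mono {y z : ℝ} (hyz : y ≤ z) {i : ℕ} (h : ∀ k < i, 0 < Real.log^[k] y) :
    Real.log^[i] y ≤ Real.log^[i] z := by
  induction i with
  | zero => exact hyz
  | succ i ih =>
    rw [Function.iterate_succ_apply', Function.iterate_succ_apply']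
    exact Real.log_le_log (h i (Nat.lt_succ_self i)) (ih fun k hk => h k (hk.trans i.lt_succ_self))

/-- A discrete form of the derivative of the iterated logarithm, by induction from `log u ≤ u - 1`.
Telescoping it yields the divergence in `not_summable_inv_logProd`. -/
lemma Real.log_iterate_sub_le {y : ℝ} {i : ℕ} (h : ∀ k < i, 0 < Real.log^[k] y) :
    Real.log^[i] (y + 1) - Real.log^[i] y ≤ (∏ k ∈ Finset.range i, Real.log^[k] y)⁻¹ := by
  induction i with
  | zero => simp
  | succ i ih =>
    have hi := h i i.lt_succ_self
    have h' : ∀ k < i, 0 < Real.log^[k] y := fun k hk => h k (hk.trans i.lt_succ_self)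
    have hi1 : 0 < Real.log^[i] (y + 1) := hi.trans_le (Real.log_iterate_mono (by linarith) h')
    rw [Function.iterate_succ_apply', Function.iterate_succ_apply', Finset.prod_range_succ,
      ← Real.log_div hi1.ne' hi.ne', mul_inv]
    calc Real.log (Real.log^[i] (y + 1) / Real.log^[i] y)
        ≤ Real.log^[i] (y + 1) / Real.log^[i] y - 1 := Real.log_le_sub_one_of_pos (by positivity)
      _ = (Real.log^[i] (y + 1) - Real.log^[i] y) * (Real.log^[i] y)⁻¹ := by field_simp
      _ ≤ _ := by
        gcongr
        exact ih h'

/-- The iterated logarithms up to order `s` are at least `1` at `y`. -/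
def LogIterateGeOne (s : ℕ) (y : ℝ) : Prop := ∀ i ≤ s, 1 ≤ Real.log^[i] y

lemma eventually_logIterateGeOne (s : ℕ) : ∀ᶠ y : ℝ in atTop, LogIterateGeOne s y := by
  have : ∀ᶠ y : ℝ in atTop, ∀ i ∈ Finset.range (s + 1), 1 ≤ Real.log^[i] y :=
    (Filter.eventually_all_finset _).2 fun i _ =>
      (Real.tendsto_log_iterate_atTop i).eventually_ge_atTop 1
  filter_upwards [this] with y hy i hi
  exact hy i (Finset.mem_range.2 (Nat.lt_succ_of_le hi))

lemma LogIterateGeOne.pos {s i : ℕ} {y : ℝ} (h : LogIterateGeOne s y) (hi : i ≤ s) :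
    0 < Real.log^[i] y := one_pos.trans_le (h i hi)

lemma LogIterateGeOne.le {s i : ℕ} {y z : ℝ} (h : LogIterateGeOne s y) (hyz : y ≤ z) (hi : i ≤ s) :
    Real.log^[i] y ≤ Real.log^[i] z :=
  Real.log_iterate_mono hyz fun _ hk => h.pos (hk.le.trans hi)

lemma LogIterateGeOne.mono {s : ℕ} {y z : ℝ} (h : LogIterateGeOne s y) (hyz : y ≤ z) :
    LogIterateGeOne s z := fun i hi => (h i hi).trans (h.le hyz hi)

/-- The product `y · log y ⋯ log^{(s)} y`. -/
noncomputable def logProd (s : ℕ) (y : ℝ) : ℝ := ∏ i ∈ Finset.range (s + 1), Real.log^[i] y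

lemma logProd_pos {s : ℕ} {y : ℝ} (h : LogIterateGeOne s y) : 0 < logProd s y :=
  Finset.prod_pos fun _ hi => h.pos (Nat.lt_succ_iff.1 (Finset.mem_range.1 hi))

lemma logProd_mono {s : ℕ} {y z : ℝ} (h : LogIterateGeOne s y) (hyz : y ≤ z) :
    logProd s y ≤ logProd s z := by
  refine Finset.prod_le_prod (fun i hi => ?_) fun i hi => ?_
  · exact (h.pos (Nat.lt_succ_iff.1 (Finset.mem_range.1 hi))).le
  · exact h.le hyz (Nat.lt_succ_iff.1 (Finset.mem_range.1 hi))

lemma mul_logProd_le {s : ℕ} {y c : ℝ} (h : LogIterateGeOne s y) (hc : 1 ≤ c) :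
    c * logProd s y ≤ logProd s (c * y) := by
  have hy0 : 0 < y := h.pos (Nat.zero_le s)
  have hy : y ≤ c * y := by nlinarith
  rw [logProd, logProd, Finset.prod_range_succ', Finset.prod_range_succ', mul_comm c, mul_assoc]
  have : Real.log^[0] y * c = Real.log^[0] (c * y) := by simp [mul_comm]
  rw [this]
  have h0 : 0 ≤ Real.log^[0] (c * y) := (hy0.trans_le hy).le
  gcongr with i hi
  · exact fun i hi => (h.pos (Finset.mem_range.1 hi)).le
  · exact h.le hy (Finset.mem_range.1 hi)

lemma le_logProd {s : ℕ} {y : ℝ} (h : LogIterateGeOne s y) : y ≤ logProd s y := by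
  rw [logProd, Finset.prod_range_succ']
  refine le_mul_of_one_le_left (h.pos (Nat.zero_le s)).le ?_
  exact Finset.one_le_prod fun i hi => h (i + 1) (Finset.mem_range.1 hi)

lemma logProd_le {s : ℕ} {y : ℝ} (h : LogIterateGeOne s y) :
    logProd s y ≤ y * Real.log y ^ s := by
  have hlog (i : ℕ) (hi : i < s) : Real.log^[i + 1] y ≤ Real.log y := by
    induction i with
    | zero => exact le_rfl
    | succ i ih =>
      refine le_trans ?_ (ih (by omega))
      rw [Function.iterate_succ_apply']
      exact Real.log_le_self (h.pos hi.le).le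
  rw [logProd, Finset.prod_range_succ', mul_comm]
  refine mul_le_mul_of_nonneg_left ?_ (h.pos (Nat.zero_le s)).le
  calc ∏ i ∈ Finset.range s, Real.log^[i + 1] y ≤ ∏ i ∈ Finset.range s, Real.log y :=
        Finset.prod_le_prod (fun i hi => (h.pos (Finset.mem_range.1 hi)).le)
          fun i hi => hlog i (Finset.mem_range.1 hi)
    _ = _ := by simp

lemma eventually_logProd_le_sq_div (s : ℕ) :
    ∀ᶠ y : ℝ in atTop, logProd s y ≤ (y / 4) ^ 2 := by
  have h := (Real.isLittleO_pow_log_id_atTop (n := s)).bound (show (0 : ℝ) < 1 / 16 by norm_num)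
  filter_upwards [h, eventually_logIterateGeOne s, eventually_ge_atTop 1] with y h1 h2 h3
  have hy : 0 ≤ y := by linarith
  have h4 : Real.log y ^ s ≤ 1 / 16 * y := by
    refine (le_abs_self _).trans ?_
    simpa [abs_of_nonneg hy] using h1
  calc logProd s y ≤ y * Real.log y ^ s := logProd_le h2
    _ ≤ y * (1 / 16 * y) := by gcongr
    _ = _ := by ring

/-- This is the comparison behind Cauchy condensation: since `log (2^j) ≤ j`, one logarithm is
stripped from each factor except the first. -/
lemma logProd_two_pow_le {s j : ℕ} (h : LogIterateGeOne (s + 1) ((2 : ℝ) ^ j)) :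
    logProd (s + 1) ((2 : ℝ) ^ j) ≤ 2 ^ j * logProd s j := by
  rw [logProd, Finset.prod_range_succ', mul_comm]
  have h2 : (0 : ℝ) ≤ 2 ^ j := by positivity
  have hle : Real.log ((2 : ℝ) ^ j) ≤ j := by
    rw [Real.log_pow]
    have : Real.log 2 ≤ 1 := by linarith [Real.log_two_lt_d9]
    nlinarith [(Nat.cast_nonneg j : (0 : ℝ) ≤ j)]
  change 2 ^ j * _ ≤ 2 ^ j * _
  gcongr
  refine Finset.prod_le_prod (fun i hi => (h.pos (Finset.mem_range.1 hi)).le) fun i hi => ?_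
  rw [Function.iterate_succ_apply]
  refine Real.log_iterate_mono hle fun k hk => ?_
  rw [← Function.iterate_succ_apply]
  exact h.pos (by have := Finset.mem_range.1 hi; omega)

theorem not_summable_inv_logProd (s : ℕ) : ¬ Summable fun n : ℕ => (logProd s n)⁻¹ := by
  intro hsum
  obtain ⟨n₀, hn₀⟩ := eventually_atTop.1
    (tendsto_natCast_atTop_atTop.eventually (eventually_logIterateGeOne s))
  rw [← summable_nat_add_iff n₀] at hsum
  have hbound (N : ℕ) : Real.log^[s + 1] ((N + n₀ : ℕ) : ℝ) - Real.log^[s + 1] (n₀ : ℝ)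
      ≤ ∑' n : ℕ, (logProd s (n + n₀ : ℕ))⁻¹ := by
    refine le_trans ?_ (hsum.sum_le_tsum (Finset.range N) fun n _ =>
      inv_nonneg.2 (logProd_pos (hn₀ _ (by omega))).le)
    have ht := Finset.sum_range_sub (fun n : ℕ => Real.log^[s + 1] ((n + n₀ : ℕ) : ℝ)) N
    rw [Nat.zero_add] at ht
    rw [← ht]
    refine Finset.sum_le_sum fun n _ => ?_
    have h := Real.log_iterate_sub_le (y := ((n + n₀ : ℕ) : ℝ)) (i := s + 1)
      fun k hk => (hn₀ (n + n₀) (by omega)).pos (Nat.lt_succ_iff.1 hk)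
    have e : ((n + 1 + n₀ : ℕ) : ℝ) = ((n + n₀ : ℕ) : ℝ) + 1 := by push_cast; ring
    rw [e]
    exact h
  have htend : Tendsto (fun N : ℕ => Real.log^[s + 1] ((N + n₀ : ℕ) : ℝ)) atTop atTop :=
    (Real.tendsto_log_iterate_atTop (s + 1)).comp
      (tendsto_natCast_atTop_atTop.comp (tendsto_add_atTop_nat n₀))
  obtain ⟨N, hN⟩ := (htend.eventually_gt_atTop
    (Real.log^[s + 1] (n₀ : ℝ) + ∑' n : ℕ, (logProd s (n + n₀ : ℕ))⁻¹)).exists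
  linarith [hbound N]

/-! ### The auxiliary rate with one more logarithm -/

/-- The rate `psi (s + 1) d`, made constant on the integers up to `q₀`. -/
noncomputable def truncatedPsi (s d q₀ q : ℕ) : ℝ :=
  logProd (s + 1) (max q q₀ : ℕ) ^ (-(1 / (d : ℝ)))

section truncatedPsi

variable {s d q₀ : ℕ}

lemma logIterateGeOne_max (hq₀ : LogIterateGeOne (s + 1) (q₀ : ℝ)) (q : ℕ) :
    LogIterateGeOne (s + 1) ((max q q₀ : ℕ) : ℝ) :=
  hq₀.mono (by exact_mod_cast le_max_right q q₀)

lemma truncatedPsi_pos (hq₀ : LogIterateGeOne (s + 1) (q₀ : ℝ)) (q : ℕ) :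
    0 < truncatedPsi s d q₀ q :=
  Real.rpow_pos_of_pos (logProd_pos (logIterateGeOne_max hq₀ q)) _

lemma truncatedPsi_antitone (hq₀ : LogIterateGeOne (s + 1) (q₀ : ℝ)) :
    Antitone (truncatedPsi s d q₀) := by
  intro p q hpq
  have h := logIterateGeOne_max hq₀ p
  refine Real.rpow_le_rpow_of_nonpos (logProd_pos h) (logProd_mono h ?_) ?_
  · exact_mod_cast max_le_max_right q₀ hpq
  · rw [neg_nonpos]; positivity

lemma truncatedPsi_pow (hd : 0 < d) (hq₀ : LogIterateGeOne (s + 1) (q₀ : ℝ)) (q : ℕ) :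
    truncatedPsi s d q₀ q ^ d = (logProd (s + 1) (max q q₀ : ℕ))⁻¹ := by
  have hd' : (d : ℝ) ≠ 0 := by exact_mod_cast hd.ne'
  rw [truncatedPsi, ← Real.rpow_natCast, ← Real.rpow_mul (logProd_pos (logIterateGeOne_max hq₀ q)).le,
    neg_mul, one_div_mul_cancel hd', Real.rpow_neg_one]

lemma truncatedPsi_le_half (hd : 0 < d) (hq₀ : LogIterateGeOne (s + 1) (q₀ : ℝ))
    (h2 : 2 ^ d ≤ q₀) (q : ℕ) : truncatedPsi s d q₀ q ≤ 1 / 2 := by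
  refine le_of_pow_le_pow_left₀ hd.ne' (by norm_num) ?_
  rw [truncatedPsi_pow hd hq₀, one_div, inv_pow]
  gcongr
  calc (2 : ℝ) ^ d ≤ (max q q₀ : ℕ) := by exact_mod_cast h2.trans (le_max_right q q₀)
    _ ≤ _ := le_logProd (logIterateGeOne_max hq₀ q)

lemma truncatedPsi_two_mul_le (hd : 0 < d) (hq₀ : LogIterateGeOne (s + 1) (q₀ : ℝ)) {q : ℕ}
    (hq : q₀ ≤ q) :
    truncatedPsi s d q₀ (2 * q) ≤ 2 ^ (-(1 / (d : ℝ))) * truncatedPsi s d q₀ q := by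
  have h := logIterateGeOne_max hq₀ q
  have hpos := logProd_pos h
  rw [truncatedPsi, truncatedPsi, ← Real.mul_rpow two_pos.le hpos.le]
  refine Real.rpow_le_rpow_of_nonpos (by positivity) ?_ (by rw [neg_nonpos]; positivity)
  have e : ((max (2 * q) q₀ : ℕ) : ℝ) = 2 * (max q q₀ : ℕ) := by
    rw [max_eq_left (by omega), max_eq_left hq]; push_cast; rfl
  rw [e]
  exact mul_logProd_le h one_le_two

/-- Raised to the power `d`, the claim becomes `logProd (s + 1) q ≤ (q / 4) ^ d`, already true with
exponent `2`. -/
lemma eventually_four_le_mul_truncatedPsi (hd : 2 ≤ d)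
    (hq₀ : LogIterateGeOne (s + 1) (q₀ : ℝ)) :
    ∀ᶠ q : ℕ in atTop, 4 ≤ q * truncatedPsi s d q₀ q := by
  filter_upwards [tendsto_natCast_atTop_atTop.eventually (eventually_logProd_le_sq_div (s + 1)),
    eventually_ge_atTop q₀, eventually_ge_atTop 4] with q h1 h2 h3
  have h3' : (4 : ℝ) ≤ q := by exact_mod_cast h3
  have hf := truncatedPsi_pos (d := d) hq₀ q
  have hL := logProd_pos (logIterateGeOne_max hq₀ q)
  rw [← div_le_iff₀' (by linarith)]
  refine le_of_pow_le_pow_left₀ (n := d) (by omega) hf.le ?_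
  rw [truncatedPsi_pow (by omega) hq₀, ← inv_div, inv_pow]
  rw [max_eq_left h2] at hL ⊢
  gcongr
  refine h1.trans (pow_le_pow_right₀ ?_ hd)
  rw [one_le_div (by norm_num)]
  exact h3'

lemma not_summable_two_pow_mul_truncatedPsi (hd : 0 < d)
    (hq₀ : LogIterateGeOne (s + 1) (q₀ : ℝ)) :
    ¬ Summable fun j : ℕ => (2 : ℝ) ^ j * truncatedPsi s d q₀ (2 ^ j) ^ d := by
  intro h
  apply not_summable_inv_logProd s
  rw [← summable_nat_add_iff q₀] at h ⊢
  have hge (j : ℕ) : LogIterateGeOne s ((j + q₀ : ℕ) : ℝ) :=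
    fun i hi => (hq₀.mono (by push_cast; linarith [(Nat.cast_nonneg j : (0 : ℝ) ≤ j)])) i (by omega)
  refine Summable.of_nonneg_of_le (fun j => inv_nonneg.2 (logProd_pos (hge j)).le)
    (fun j => ?_) h
  have hj : q₀ ≤ 2 ^ (j + q₀) := (Nat.le_add_left q₀ j).trans Nat.lt_two_pow_self.le
  rw [truncatedPsi_pow hd hq₀, max_eq_left hj]
  push_cast
  have h1 : LogIterateGeOne (s + 1) ((2 : ℝ) ^ (j + q₀)) := hq₀.mono (by exact_mod_cast hj)
  have h2 := logProd_two_pow_le h1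
  have h3 := logProd_pos h1
  have h4 := logProd_pos (hge j)
  push_cast at h2 h4
  rw [← div_eq_mul_inv, inv_eq_one_div, div_le_div_iff₀ h4 h3]
  linarith

/-- The additional logarithm makes the ratio of the two rates tend to `0`, which pays for the
constant from the zero-one law. -/
lemma eventually_mul_truncatedPsi_le_psi (hd : 0 < d) (c : ℝ) :
    ∀ᶠ q : ℕ in atTop, c * truncatedPsi s d q₀ q ≤ psi s d q := by
  have hd' : (0 : ℝ) < d := by exact_mod_cast hd
  have hlim : Tendsto (fun q : ℕ => c * Real.log^[s + 1] (q : ℝ) ^ (-(1 / (d : ℝ)))) atTop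
      (𝓝 0) := by
    rw [← mul_zero c]
    exact ((tendsto_rpow_neg_atTop (by positivity)).comp
      ((Real.tendsto_log_iterate_atTop (s + 1)).comp tendsto_natCast_atTop_atTop)).const_mul c
  filter_upwards [hlim.eventually_le_const one_pos, eventually_ge_atTop q₀,
    tendsto_natCast_atTop_atTop.eventually (eventually_logIterateGeOne (s + 1))] with q h1 h2 h3
  have h4 : LogIterateGeOne s (q : ℝ) := fun i hi => h3 i (by omega)
  have e : psi s d q = logProd s q ^ (-(1 / (d : ℝ))) := rfl
  have hpos := logProd_pos h4
  have hpow := Real.rpow_pos_of_pos hpos (-(1 / (d : ℝ)))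
  rw [truncatedPsi, max_eq_left h2, logProd, Finset.prod_range_succ, ← logProd,
    Real.mul_rpow hpos.le (h3.pos le_rfl).le, e]
  calc c * (logProd s q ^ (-(1 / (d : ℝ))) * Real.log^[s + 1] (q : ℝ) ^ (-(1 / (d : ℝ))))
      = logProd s q ^ (-(1 / (d : ℝ))) * (c * Real.log^[s + 1] (q : ℝ) ^ (-(1 / (d : ℝ)))) := by
        ring
    _ ≤ logProd s q ^ (-(1 / (d : ℝ))) * 1 := by gcongr
    _ = _ := mul_one _

end truncatedPsi

/-! ### Return to the fiber and conclusion -/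

lemma fiberPoint_mem_approximableSet {d : ℕ} {x : ℝ} {f ψ : ℕ → ℝ} {c : ℝ}
    {y : Fin (d - 1) → ℝ} (hf : ∀ᶠ q in atTop, f q ≤ ψ q) (hcf : ∀ᶠ q in atTop, c * f q ≤ ψ q)
    (hψ : ∀ᶠ q in atTop, 0 < ψ q)
    (h : ∃ᶠ q in atTop, q ∈ nearIntegerDens x f ∧
      (fun i => (y i : UnitAddCircle)) ∈ torusNear (d - 1) q (c * f q)) :
    fiberPoint x y ∈ approximableSet d ψ := by
  let p : ℕ → Fin d → ℤ := fun q i => round (q * fiberPoint x y i)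
  have hq : ∃ᶠ q : ℕ in atTop, 0 < q ∧
      ‖(q : ℝ) • fiberPoint x y - (fun i => (p q i : ℝ))‖ < ψ q := by
    refine (h.and_eventually (hf.and (hcf.and hψ))).mono ?_
    rintro q ⟨⟨hq1, hq2⟩, h1, h2, h3⟩
    refine ⟨hq1.1, (pi_norm_lt_iff h3).2 fun i => ?_⟩
    simp only [Pi.sub_apply, Pi.smul_apply, smul_eq_mul, Real.norm_eq_abs, p, fiberPoint]
    split_ifs with hi
    · exact hq1.2.trans_le h1
    · have := hq2 ⟨i.val - 1, by omega⟩
      rw [← AddCircle.coe_nsmul, UnitAddCircle.norm_eq, nsmul_eq_mul] at this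
      exact this.trans_le h2
  have hinf := Nat.frequently_atTop_iff_infinite.1 hq
  refine (hinf.image (f := fun q => (p q, q)) fun a _ b _ hab => (Prod.ext_iff.1 hab).2).mono ?_
  rintro _ ⟨q, hq, rfl⟩
  exact hq

/-- In dimension at least three, every fiber `{x} × ℝ^{d-1}` is full. -/
theorem fullOnFiber_approximableSet_psi (d : ℕ) (hd : 3 ≤ d) (s : ℕ) (x : ℝ) :
    FullOnFiber (approximableSet d (psi s d)) x := by
  obtain ⟨q₀, hq₀, h2⟩ := ((tendsto_natCast_atTop_atTop.eventually
    (eventually_logIterateGeOne (s + 1))).and (eventually_ge_atTop (2 ^ d))).exists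
  have hd0 : 0 < d := by omega
  have hf0 := truncatedPsi_pos (d := d) hq₀
  have hf := truncatedPsi_antitone (d := d) hq₀
  have hf2 := truncatedPsi_le_half hd0 hq₀ h2
  have htwo : Tendsto (fun j : ℕ => 2 ^ j) atTop atTop :=
    tendsto_pow_atTop_atTop_of_one_lt one_lt_two
  obtain ⟨J₀, hJ₀⟩ := eventually_atTop.1 (htwo.eventually
    ((eventually_four_le_mul_truncatedPsi (by omega) hq₀ (d := d)).and (eventually_ge_atTop q₀)))
  -- Each doubling of `q ≥ q₀` shrinks the rate by at least `2 ^ (-1/d)`, so its `(d - 1)`-th power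
  -- decays geometrically along powers of two.
  have hθ : ((2 : ℝ) ^ (-(1 / (d : ℝ)))) ^ (d - 1) < 1 := by
    refine pow_lt_one₀ (by positivity) ?_ (by omega)
    exact Real.rpow_lt_one_of_one_lt_of_neg one_lt_two (by rw [neg_lt_zero]; positivity)
  have hdiv := not_summable_indicator_nearIntegerDens x hf hf0 hf2 (m := d - 1) hθ (J₀ := J₀)
    (fun j hj => by
      rw [← mul_pow, pow_succ']
      have := hf0 (2 * 2 ^ j)
      gcongr
      exact truncatedPsi_two_mul_le hd0 hq₀ (hJ₀ j hj).2)
    (fun j hj => by have := (hJ₀ j hj).1; push_cast at this; exact this)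
    (by rw [Nat.sub_add_cancel hd0]; exact not_summable_two_pow_mul_truncatedPsi hd0 hq₀)
  have hae := ae_real_of_ae_torus (ae_frequently_torusNear hf hf0 hf2 (m := d - 1) (by omega) hdiv)
  refine measure_mono_null ?_ (ae_iff.1 hae)
  refine fun y hy hc => hy ?_
  obtain ⟨c, hc⟩ := hc
  have h1 := eventually_mul_truncatedPsi_le_psi (s := s) (q₀ := q₀) hd0 1
  simp only [one_mul] at h1
  exact fiberPoint_mem_approximableSet h1 (eventually_mul_truncatedPsi_le_psi hd0 c)
    (h1.mono fun q hq => (hf0 q).trans_le hq) hc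

theorem theorem2 (d : ℕ) (hd : 3 ≤ d) (s : ℕ) (x : ℝ)
    (hx : (d : ℝ≥0∞) < diophantineType ![x] ∨ 1 < regularDiophantineType x) :
    FullOnFiber (approximableSet d (psi s d)) x :=
  fullOnFiber_approximableSet_psi d hd s x
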